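/- **Setting.** Let $d\ge 2$, let $p\in[2,\infty]$ with Hölder conjugate $q$ ($1/p+1/q=1$), and let $\mathcal D$ be a distribution of $(x,y)\in\mathbb R^d\times\{\pm1\}$ with marginal $\mathcal D_x$ such that $\|x\|_p\le 1$ almost surely. For $w\in\mathbb R^d$ and $r\ge 0$ let $$\mathrm{err}^{p,r}_{\mathcal D}(w)=\mathbb P_{(x,y)\sim\mathcal D}\big[\exists x':\ \|x'-x\|_p\le r,\ \mathrm{sgn}(\langle w,x'\rangle)\ne y\big]$$ (with $\mathrm{sgn}(0)=0$, so that a tie counts as an error) and $\mathsf{OPT}=\mathsf{OPT}_{p,r}=\min_{\|w\|_q=1}\mathrm{err}^{p,r}_{\mathcal D}(w)$. Suppose that $\mathcal D_x$ satisfies $U$-anti-concentration and $(U',R)$-anti-anti-concentration: for every pair of orthonormal vectors $v,v'$, the vector $(\langle v,x\rangle,\langle v',x\rangle)$, $x\sim\mathcal D_x$, has a density on $\mathbb R^2$ that is at most $U$ everywhere and at least $1/U'$ at all $z$ with $\|z\|_2\le R$. **Algorithm.** Adversarial training with the cross-entropy loss $\ell(z)=\log(1+e^{-z})$, step size $\eta$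 and an i.i.d. sample $(x_1,y_1),\dots,(x_n,y_n)$ from $\mathcal D$ starts from $w_0=0$ and iterates $$\delta_{k,i}\in\operatorname*{arg\,max}_{\|\delta\|_p\le r}\ell\big(y_i\langle w_k,x_i+\delta\rangle\big),\qquad w_{k+1}=w_k-\frac{\eta}{n}\sum_{i=1}^n\ell'\big(y_i\langle w_k,x_i+\delta_{k,i}\rangle\big)\,y_i\,(x_i+\delta_{k,i}).$$ **Claim.** For all $U,U',R>0$ there are constants $C>0$ and $m\in\mathbb N$, depending only on $U,U',R$, such that the following holds for all $d$, $p$, $\mathcal D$ as above and all $0\le r\le R$, $0<\delta<1$ and $0<\eta\le \mathsf{OPT}/(4H)$, where $H=4$ if $p\le 2$ and $H=4d$ if $p>2$. Write $\Lambda=\log(d/\mathsf{OPT})$. If $$n\ \ge\ C\,\log^m\!\Big(\frac{d}{\delta\,\mathsf{OPT}}\Big)\; d^{\,1-\frac2p}\,\mathsf{OPT}^{-2},$$ then with probability at least $1-\delta$ over the sample there is, in every run of adversarial training, an iterate $w_k$ with $$k\ \le\ C\,\Lambda^m\;\eta^{-1}\,d^{\,\frac{3}{2p}-\frac34}\,\mathsf{OPT}^{-3}$$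 and $$\mathrm{err}^{p,r}_{\mathcal D}(w_k)\ \le\ C\,\Lambda^m\Big(d^{\,\frac14-\frac1{2p}}\sqrt{\mathsf{OPT}_{p,r}}+d^{\,\frac12-\frac1p}\,\mathsf{OPT}_{p,r}\Big).$$ In particular, $\mathrm{err}^{2,r}_{\mathcal D}(w_k)\le C\,\Lambda^m\sqrt{\mathsf{OPT}_{2,r}}$ for $p=2$, and $\mathrm{err}^{\infty,r}_{\mathcal D}(w_k)\le C\,\Lambda^m\big(d^{1/4}\sqrt{\mathsf{OPT}_{\infty,r}}+d^{1/2}\,\mathsf{OPT}_{\infty,r}\big)$ for $p=\infty$. -/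

import Mathlib

open MeasureTheory
open scoped ENNReal

namespace AdvHalfspace

/-- The `ℓ_p` norm on `ℝ^d`, for `p ∈ [1, ∞]`. -/
noncomputable def vecNorm {d : ℕ} (p : ℝ≥0∞) (x : Fin d → ℝ) : ℝ :=
  ‖WithLp.toLp p x‖

/-- The robust classification error of the halfspace `x ↦ sgn ⟨w, x⟩` under `ℓ_p` perturbations of
radius `r`: the probability, over `(x, y) ∼ D`, that some `x'` with `‖x' - x‖_p ≤ r` is not given
the label `y ∈ {1, -1}`. As `Real.sign 0 = 0`, a tie `⟨w, x'⟩ = 0` counts as an error. -/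
noncomputable def robustError {d : ℕ} (D : Measure ((Fin d → ℝ) × ℝ)) (p : ℝ≥0∞) (r : ℝ)
    (w : Fin d → ℝ) : ℝ :=
  D.real {z | ∃ x' : Fin d → ℝ, vecNorm p (x' - z.1) ≤ r ∧ Real.sign (w ⬝ᵥ x') ≠ z.2}

/-- The best robust error of a halfspace: the minimum of the robust error (for `ℓ_p` perturbations
of radius `r`) over the unit sphere of the `ℓ_q` norm. -/
noncomputable def robustOpt {d : ℕ} (D : Measure ((Fin d → ℝ) × ℝ)) (p q : ℝ≥0∞) (r : ℝ) : ℝ :=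
  ⨅ w : {w : Fin d → ℝ // vecNorm q w = 1}, robustError D p r w

/-- `f` is a density, with respect to Lebesgue measure on `ℝ²`, of the marginal of `μ` on the plane
spanned by `v` and `v'`, in the coordinates given by the orthonormal vectors `v`, `v'`. -/
def IsMarginalDensity {d : ℕ} (μ : Measure (Fin d → ℝ)) (v v' : Fin d → ℝ) (f : ℝ × ℝ → ℝ≥0∞) :
    Prop :=
  Measurable f ∧ μ.map (fun x => (v ⬝ᵥ x, v' ⬝ᵥ x)) = volume.withDensity f

/-- `v`, `v'` is an orthonormal pair for the Euclidean inner product. -/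
def IsOrthonormalPair {d : ℕ} (v v' : Fin d → ℝ) : Prop :=
  v ⬝ᵥ v = 1 ∧ v' ⬝ᵥ v' = 1 ∧ v ⬝ᵥ v' = 0

/-- `U`-anti-concentration: every two-dimensional marginal of `μ` has a density that is at most
`U` everywhere. -/
def AntiConcentrated {d : ℕ} (μ : Measure (Fin d → ℝ)) (U : ℝ) : Prop :=
  ∀ v v' : Fin d → ℝ, IsOrthonormalPair v v' →
    ∃ f, IsMarginalDensity μ v v' f ∧ ∀ z, f z ≤ ENNReal.ofReal U

/-- `(U', R)`-anti-anti-concentration: every two-dimensional marginal of `μ` has a density that is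
at least `1 / U'` on the Euclidean ball of radius `R` about the origin. -/
def AntiAntiConcentrated {d : ℕ} (μ : Measure (Fin d → ℝ)) (U' R : ℝ) : Prop :=
  ∀ v v' : Fin d → ℝ, IsOrthonormalPair v v' →
    ∃ f, IsMarginalDensity μ v v' f ∧
      ∀ z : ℝ × ℝ, z.1 ^ 2 + z.2 ^ 2 ≤ R ^ 2 → ENNReal.ofReal (1 / U') ≤ f z

/-- The cross-entropy loss `ℓ(z) = log (1 + exp (-z))`. -/
noncomputable def crossEntropy (z : ℝ) : ℝ := Real.log (1 + Real.exp (-z))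

/-- `w 0, w 1, w 2, …` are the iterates of adversarial training on the sample `S` with the
cross-entropy loss and step size `η`. In step `k`, each `x_i` is perturbed by a maximizer `δ k i` of
`δ ↦ ℓ(y_i ⟨w k, x_i + δ⟩)` over the `ℓ_p` ball of radius `r` (any one, if there are several), and
then a gradient step is made in which the perturbed samples are treated as constants. -/
def IsAdversarialTraining {d n : ℕ} (p : ℝ≥0∞) (r η : ℝ) (S : Fin n → (Fin d → ℝ) × ℝ)
    (w : ℕ → Fin d → ℝ) : Prop :=
  ∃ δ : ℕ → Fin n → Fin d → ℝ,
    (∀ k i, vecNorm p (δ k i) ≤ r ∧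
      ∀ δ' : Fin d → ℝ, vecNorm p δ' ≤ r →
        crossEntropy ((S i).2 * (w k ⬝ᵥ ((S i).1 + δ'))) ≤
          crossEntropy ((S i).2 * (w k ⬝ᵥ ((S i).1 + δ k i)))) ∧
    ∀ k, w (k + 1) = w k - (η / n) • ∑ i,
      (deriv crossEntropy ((S i).2 * (w k ⬝ᵥ ((S i).1 + δ k i))) * (S i).2) •
        ((S i).1 + δ k i)

end AdvHalfspace

open AdvHalfspace

/-! Write `B = d ^ (1/2 - 1/p)` and `o = OPT`. The lower density bound has two consequences that
reduce the problem to ordinary logistic regression. Every halfspace can be fooled near its decision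
boundary, so `o ≥ r R / (2 U')` (`le_robustError`): the radius is `O(o)`, and a perturbation moves
the margin of a Euclidean unit vector by at most `B r = O(B o)`. Moreover every coordinate has
second moment bounded below while `‖x‖₂ ≤ B`, so `d = O(B²)` (`AntiAntiConcentrated.dim_le`), and a
sample of size `B² / o²`, up to logarithms, affords a union bound over a grid of halfspaces.

The iterates are compared with `u = ε⁻¹ • v`, where `v` is a unit vector of robust error at most `2
o`. As the marginal along `v` has bounded density, points near the boundary contribute `O(ε)` to the
expected adversarial loss of `u`; misclassified points contribute `O(B / ε) * o`. The choice `ε =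
√(B o)` balances the two. This bound holds whatever the perturbations are
(`crossEntropy_le_competitorLoss`), so it does not matter that they depend on the iterate.

Convexity and `ℓ'² ≤ ℓ` make `‖w k - u‖²` drop by `η ε` per step while the average loss exceeds `2 b
+ ε`, with `b` a bound for the loss of `u`. Hence some iterate within `‖u‖² / (η ε) = 1 / (η ε³)`
steps has empirical loss `O(ε)` (`exists_iterate_loss_le`), and its empirical error is `O(ε)` too.
`robustError_le_empirical` carries this over to the robust error under `D`, at the price of a slab
of width `O(B o)`. The resulting error `O(√(B o))` is the first summand of the claim. -/

namespace AdvHalfspace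

/-! ### Concentration of empirical means -/

/-- Hoeffding's inequality for the empirical mean of a bounded function on an i.i.d. sample. -/
theorem measure_pi_sum_ge_le {Z : Type*} [MeasurableSpace Z] (D : Measure Z)
    [IsProbabilityMeasure D] {f : Z → ℝ} (hf : Measurable f) {G : ℝ}
    (hfG : ∀ z, f z ∈ Set.Icc 0 G) {t : ℝ} (ht : 0 ≤ t) (n : ℕ) :
    (Measure.pi fun _ : Fin n => D) {S | n * (∫ z, f z ∂D + t) ≤ ∑ i, f (S i)} ≤
      ENNReal.ofReal (Real.exp (-(2 * n * t ^ 2 / G ^ 2))) := by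
  have hsub := ProbabilityTheory.hasSubgaussianMGF_of_mem_Icc (μ := D) hf.aemeasurable
    (Filter.Eventually.of_forall hfG)
  set c := ∫ z, f z ∂D with hc
  set P := Measure.pi fun _ : Fin n => D with hP
  have hind : ProbabilityTheory.iIndepFun (fun i (S : Fin n → Z) => f (S i) - c) P :=
    ProbabilityTheory.iIndepFun_pi (X := fun _ z => f z - c)
      (fun _ => (hf.sub_const c).aemeasurable)
  have hmap : ∀ i : Fin n, P.map (fun S => S i) = D := fun i =>
    (measurePreserving_eval (fun _ : Fin n => D) i).map_eq
  have hs : ∀ i ∈ (Finset.univ : Finset (Fin n)),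
      ProbabilityTheory.HasSubgaussianMGF (fun S : Fin n → Z => f (S i) - c)
        ((‖G - 0‖₊ / 2) ^ 2) P := by
    intro i _
    exact ProbabilityTheory.HasSubgaussianMGF.of_map (Y := fun S : Fin n → Z => S i)
      (X := fun z => f z - c) (measurable_pi_apply i).aemeasurable (by rw [hmap i]; exact hsub)
  have h := ProbabilityTheory.HasSubgaussianMGF.measure_sum_ge_le_of_iIndepFun hind hs
    (ε := n * t) (by positivity)
  have hset : {S : Fin n → Z | n * (c + t) ≤ ∑ i, f (S i)} =
      {S | (n : ℝ) * t ≤ ∑ i, (f (S i) - c)} := by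
    ext S
    simp only [Set.mem_ofPred_eq, Finset.sum_sub_distrib, Finset.sum_const, Finset.card_univ,
      Fintype.card_fin, nsmul_eq_mul]
    constructor <;> intro h <;> linarith
  rw [hset, ← ENNReal.ofReal_toReal (measure_ne_top P _)]
  refine ENNReal.ofReal_le_ofReal (h.trans (le_of_eq ?_))
  congr 1
  rcases Nat.eq_zero_or_pos n with rfl | hn
  · simp
  simp only [sub_zero, Finset.sum_const, Finset.card_univ, Fintype.card_fin, nsmul_eq_mul,
    NNReal.coe_mul, NNReal.coe_natCast, NNReal.coe_pow, NNReal.coe_div, coe_nnnorm,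
    NNReal.coe_ofNat, Real.norm_eq_abs, div_pow, sq_abs]
  have : (n : ℝ) ≠ 0 := by positivity
  -- For `G = 0` both exponents are quotients by zero, hence `0`.
  rcases eq_or_ne G 0 with rfl | hG
  · simp
  field_simp

/-! ### Comparison of `ℓ_p` and Euclidean norms -/

variable {d : ℕ}

theorem dotProduct_sq_le (v w : Fin d → ℝ) : (v ⬝ᵥ w) ^ 2 ≤ (v ⬝ᵥ v) * (w ⬝ᵥ w) := by
  have := Finset.sum_mul_sq_le_sq_mul_sq Finset.univ v w
  simpa [dotProduct, sq] using this

theorem dotProduct_self_nonneg' (v : Fin d → ℝ) : 0 ≤ v ⬝ᵥ v :=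
  Finset.sum_nonneg fun i _ => mul_self_nonneg (v i)

theorem vecNorm_top (x : Fin d → ℝ) : vecNorm ∞ x = ⨆ i, |x i| := rfl

theorem vecNorm_eq_sum {p : ℝ≥0∞} (hp : 0 < p.toReal) (x : Fin d → ℝ) :
    vecNorm p x = (∑ i, |x i| ^ p.toReal) ^ (1 / p.toReal) := by
  simp [vecNorm, PiLp.norm_eq_sum hp]

theorem abs_apply_le_vecNorm {p : ℝ≥0∞} (hp : 2 ≤ p) (x : Fin d → ℝ) (i : Fin d) :
    |x i| ≤ vecNorm p x := by
  have : Fact (1 ≤ p) := ⟨le_trans (by norm_num) hp⟩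
  simpa [vecNorm] using PiLp.norm_apply_le (WithLp.toLp p x) i

theorem vecNorm_zero (p : ℝ≥0∞) (hp : 1 ≤ p) : vecNorm p (0 : Fin d → ℝ) = 0 := by
  have : Fact (1 ≤ p) := ⟨hp⟩
  simp [vecNorm]

theorem two_le_toReal {p : ℝ≥0∞} (hp : 2 ≤ p) (hp' : p ≠ ∞) : 2 ≤ p.toReal := by
  have := ENNReal.toReal_mono hp' hp
  simpa using this

/-- The Euclidean norm is at most `d ^ (1/2 - 1/p)` times the `ℓ_p` norm, for `p ≥ 2`. -/
theorem dotProduct_self_le_vecNorm {p : ℝ≥0∞} (hp : 2 ≤ p) (hd : 0 < d) (x : Fin d → ℝ) :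
    x ⬝ᵥ x ≤ (d : ℝ) ^ (1 - 2 * p⁻¹.toReal) * vecNorm p x ^ 2 := by
  rcases eq_or_ne p ∞ with rfl | hp'
  · have h : ∀ i ∈ Finset.univ, x i * x i ≤ vecNorm ∞ x ^ 2 := fun i _ => by
      have := abs_apply_le_vecNorm hp x i
      have h0 := abs_nonneg (x i)
      rw [← abs_mul_abs_self (x i)]
      nlinarith
    have := Finset.sum_le_card_nsmul _ _ _ h
    simpa [dotProduct] using this
  have ht := two_le_toReal hp hp'
  set t := p.toReal with htdef
  have ht0 : 0 < t := by linarith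
  have hS : 0 ≤ ∑ i, |x i| ^ t := Finset.sum_nonneg fun i _ => by positivity
  -- Power mean inequality for the squares `x i ^ 2` with exponent `t / 2 ≥ 1`; its `2 / t`-th power
  -- is the claim.
  have hmain := Real.rpow_sum_le_const_mul_sum_rpow (s := Finset.univ)
    (fun i : Fin d => x i ^ 2) (p := t / 2) (by linarith)
  have h1 : ∀ i : Fin d, |x i ^ 2| ^ (t / 2) = |x i| ^ t := fun i => by
    rw [abs_pow, ← Real.rpow_natCast, ← Real.rpow_mul (abs_nonneg _)]
    congr 1; push_cast; ring
  have h2 : ∑ i, |x i ^ 2| = x ⬝ᵥ x := by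
    simp [dotProduct, sq]
  simp only [h1, h2, Finset.card_univ, Fintype.card_fin] at hmain
  have h3 := Real.rpow_le_rpow (Real.rpow_nonneg (dotProduct_self_nonneg' x) _) hmain
    (z := 2 / t) (by positivity)
  rw [← Real.rpow_mul (dotProduct_self_nonneg' x), Real.mul_rpow (by positivity) hS,
    ← Real.rpow_mul (by positivity)] at h3
  have e1 : t / 2 * (2 / t) = 1 := by field_simp
  have e2 : (t / 2 - 1) * (2 / t) = 1 - 2 * p⁻¹.toReal := by
    rw [ENNReal.toReal_inv, ← htdef]; field_simp
  rw [e1, e2, Real.rpow_one] at h3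
  rw [vecNorm_eq_sum ht0, ← Real.rpow_natCast (_ ^ _), ← Real.rpow_mul hS]
  convert h3 using 3
  push_cast; ring

/-- The `ℓ_p` norm is at most the Euclidean norm, for `p ≥ 2`. -/
theorem vecNorm_le_sqrt_dotProduct {p : ℝ≥0∞} (hp : 2 ≤ p) (x : Fin d → ℝ) :
    vecNorm p x ≤ √(x ⬝ᵥ x) := by
  have hi : ∀ i, |x i| ≤ √(x ⬝ᵥ x) := fun i => by
    refine Real.abs_le_sqrt ?_
    rw [sq]
    exact Finset.single_le_sum (f := fun i => x i * x i) (fun i _ => mul_self_nonneg (x i))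
      (Finset.mem_univ i)
  rcases eq_or_ne p ∞ with rfl | hp'
  · rw [vecNorm_top]
    exact Real.iSup_le hi (Real.sqrt_nonneg _)
  have ht := two_le_toReal hp hp'
  set t := p.toReal with htdef
  have ht0 : 0 < t := by linarith
  rw [vecNorm_eq_sum ht0]
  set s := √(x ⬝ᵥ x) with hs
  have hs0 : 0 ≤ s := Real.sqrt_nonneg _
  have hsum : ∑ i, |x i| ^ t ≤ s ^ t := by
    have h : ∀ i ∈ Finset.univ, |x i| ^ t ≤ (x i * x i) * s ^ (t - 2) := fun i _ => by
      have : |x i| ^ t = |x i| ^ (2 : ℝ) * |x i| ^ (t - 2) := by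
        rw [← Real.rpow_add_of_nonneg (abs_nonneg _) (by norm_num) (by linarith)]
        congr 1; ring
      rw [this, Real.rpow_two, sq_abs, sq]
      exact mul_le_mul_of_nonneg_left
        (Real.rpow_le_rpow (abs_nonneg _) (hi i) (by linarith)) (mul_self_nonneg _)
    refine (Finset.sum_le_sum h).trans (le_of_eq ?_)
    rw [← Finset.sum_mul]
    have e : ∑ i, x i * x i = s ^ (2 : ℝ) := by
      rw [Real.rpow_two, hs, Real.sq_sqrt (dotProduct_self_nonneg' x)]; rfl
    rw [e, ← Real.rpow_add_of_nonneg hs0 (by norm_num) (by linarith)]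
    congr 1; ring
  calc _ ≤ (s ^ t) ^ (1 / t) :=
        Real.rpow_le_rpow (Finset.sum_nonneg fun i _ => by positivity) hsum (by positivity)
    _ = s := by rw [← Real.rpow_mul hs0, mul_one_div_cancel ht0.ne', Real.rpow_one]

end AdvHalfspace

/-! ### Slabs, one-dimensional marginals and the dimension -/

namespace AdvHalfspace

variable {d : ℕ}

theorem measurable_dotProduct_left (v : Fin d → ℝ) : Measurable fun x : Fin d → ℝ => v ⬝ᵥ x := by
  unfold dotProduct
  fun_prop

/-- A unit vector `v` spans, with some standard basis vector that is not too close to it, a plane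
with an orthonormal basis `v`, `v'`. -/
theorem exists_isOrthonormalPair (hd : 2 ≤ d) {v : Fin d → ℝ} (hv : v ⬝ᵥ v = 1) :
    ∃ (i : Fin d) (v' : Fin d → ℝ) (b : ℝ), 2 / 3 ≤ b ∧ IsOrthonormalPair v v' ∧
      ∀ x : Fin d → ℝ, x i = v i * (v ⬝ᵥ x) + b * (v' ⬝ᵥ x) := by
  obtain ⟨i, hi⟩ : ∃ i : Fin d, v i ^ 2 ≤ 1 / 2 := by
    by_contra! h
    have h2 : ∑ i ∈ ({⟨0, by omega⟩, ⟨1, by omega⟩} : Finset (Fin d)), v i * v i ≤ 1 := by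
      rw [← hv]
      exact Finset.sum_le_univ_sum_of_nonneg fun i => mul_self_nonneg (v i)
    rw [Finset.sum_pair (by simp)] at h2
    have := h ⟨0, by omega⟩
    have := h ⟨1, by omega⟩
    nlinarith
  -- `b` is the length of the component of the `i`-th basis vector orthogonal to `v`, and `v'` is
  -- that component normalized; `2 / 3` is a rational number below `√(1/2)`.
  set b := √(1 - v i ^ 2) with hb
  have hb2 : b ^ 2 = 1 - v i ^ 2 := Real.sq_sqrt (by linarith)
  have hb1 : 2 / 3 ≤ b := Real.le_sqrt_of_sq_le (by norm_num; linarith)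
  have hb0 : b ≠ 0 := by linarith
  have key : ∀ x : Fin d → ℝ, (b⁻¹ • (Pi.single i 1 - v i • v)) ⬝ᵥ x =
      b⁻¹ * (x i - v i * (v ⬝ᵥ x)) := fun x => by
    simp [smul_dotProduct, sub_dotProduct]
  refine ⟨i, b⁻¹ • (Pi.single i 1 - v i • v), b, hb1, ⟨hv, ?_, ?_⟩, fun x => ?_⟩
  · rw [key, dotProduct_comm, key, hv]
    simp only [Pi.smul_apply, Pi.sub_apply, Pi.single_eq_same, smul_eq_mul]
    field_simp
    linarith
  · rw [dotProduct_comm, key, hv]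
    ring
  · rw [key]
    field_simp
    ring

/-- The one-dimensional marginals of an anti-concentrated distribution on the unit cube have
bounded densities. -/
theorem AntiConcentrated.map_dotProduct_le {μ : Measure (Fin d → ℝ)} {U : ℝ}
    (hA : AntiConcentrated μ U) (hd : 2 ≤ d) (hμ : ∀ᵐ x ∂μ, ∀ i, |x i| ≤ 1)
    {v : Fin d → ℝ} (hv : v ⬝ᵥ v = 1) :
    μ.map (fun x => v ⬝ᵥ x) ≤ ENNReal.ofReal (3 * U) • volume := by
  obtain ⟨i, v', b, hb, hvv, hx⟩ := exists_isOrthonormalPair hd hv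
  obtain ⟨f, ⟨hf, hmap⟩, hfU⟩ := hA v v' hvv
  have hb0 : 0 < b := by linarith
  refine Measure.le_iff.2 fun E hE => ?_
  rw [Measure.map_apply (measurable_dotProduct_left v) hE]
  -- The second condition is `|x i| ≤ 1` in the coordinates `v`, `v'`. It confines the second
  -- coordinate to an interval of length `2 / b ≤ 3`, so integrating it out costs a factor `3`.
  set T : Set (ℝ × ℝ) := {z | z.1 ∈ E ∧ |v i * z.1 + b * z.2| ≤ 1} with hT
  have hTm : MeasurableSet T := by
    refine (measurable_fst hE).inter ?_
    exact measurableSet_le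
      (f := fun z : ℝ × ℝ => |v i * z.1 + b * z.2|) (by fun_prop) measurable_const
  have h1 : μ ((fun x => v ⬝ᵥ x) ⁻¹' E) ≤ μ ((fun x => (v ⬝ᵥ x, v' ⬝ᵥ x)) ⁻¹' T) := by
    refine measure_mono_ae ?_
    filter_upwards [hμ] with x hx1 hxE
    exact ⟨hxE, by simpa [← hx x] using hx1 i⟩
  have hsec : ∀ s, volume (Prod.mk s ⁻¹' T) ≤ E.indicator (fun _ => (3 : ℝ≥0∞)) s := by
    intro s
    by_cases hs : s ∈ E
    · rw [Set.indicator_of_mem hs]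
      have : Prod.mk s ⁻¹' T ⊆ Set.Icc ((-1 - v i * s) / b) ((1 - v i * s) / b) := by
        rintro t ⟨_, ht⟩
        rw [abs_le] at ht
        constructor
        · rw [div_le_iff₀ hb0]; linarith [ht.1]
        · rw [le_div_iff₀ hb0]; linarith [ht.2]
      refine (measure_mono this).trans ?_
      rw [Real.volume_Icc, ← sub_div]
      have h3 : (3 : ℝ≥0∞) = ENNReal.ofReal 3 := by simp
      rw [h3]
      refine ENNReal.ofReal_le_ofReal ?_
      rw [div_le_iff₀ hb0]
      linarith
    · have : Prod.mk s ⁻¹' T = ∅ := by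
        ext t; simp [hT, hs]
      simp [this]
  calc μ ((fun x => v ⬝ᵥ x) ⁻¹' E) ≤ μ ((fun x => (v ⬝ᵥ x, v' ⬝ᵥ x)) ⁻¹' T) := h1
    _ = μ.map (fun x => (v ⬝ᵥ x, v' ⬝ᵥ x)) T :=
        (Measure.map_apply ((measurable_dotProduct_left v).prodMk
          (measurable_dotProduct_left v')) hTm).symm
    _ = ∫⁻ z in T, f z := by rw [hmap, withDensity_apply _ hTm]
    _ ≤ ∫⁻ z in T, ENNReal.ofReal U := lintegral_mono fun z => hfU z
    _ = ENNReal.ofReal U * volume T := by simp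
    _ = ENNReal.ofReal U * ∫⁻ s, volume (Prod.mk s ⁻¹' T) := by
        rw [Measure.volume_eq_prod, Measure.prod_apply hTm]
    _ ≤ ENNReal.ofReal U * ∫⁻ s, E.indicator (fun _ => (3 : ℝ≥0∞)) s := by
        gcongr with s
        exact hsec s
    _ = ENNReal.ofReal U * (3 * volume E) := by rw [lintegral_indicator hE]; simp
    _ = (ENNReal.ofReal (3 * U) • (volume : Measure ℝ)) E := by
        rw [ENNReal.ofReal_mul (by norm_num)]
        simp
        ring

/-- Anti-anti-concentration bounds the mass of a slab from below. -/
theorem AntiAntiConcentrated.le_measure_slab {μ : Measure (Fin d → ℝ)} {U' R : ℝ}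
    (hA : AntiAntiConcentrated μ U' R) (hU' : 0 < U') (hd : 2 ≤ d) (hR : 0 < R)
    {v : Fin d → ℝ} (hv : v ⬝ᵥ v = 1) {a b : ℝ} (ha : -(R / 2) ≤ a) (hab : a ≤ b)
    (hb : b ≤ R / 2) :
    ENNReal.ofReal ((b - a) * R / (2 * U')) ≤ μ {x | v ⬝ᵥ x ∈ Set.Icc a b} := by
  obtain ⟨_, v', _, _, hvv, _⟩ := exists_isOrthonormalPair hd hv
  obtain ⟨f, ⟨hf, hmap⟩, hfU⟩ := hA v v' hvv
  -- Both coordinates are at most `R / 2` in absolute value, so this rectangle lies in the ball of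
  -- radius `R`.
  set T : Set (ℝ × ℝ) := Set.Icc a b ×ˢ Set.Icc 0 (R / 2) with hT
  have hTm : MeasurableSet T := measurableSet_Icc.prod measurableSet_Icc
  have hball : ∀ z ∈ T, ENNReal.ofReal (1 / U') ≤ f z := by
    rintro ⟨s, t⟩ ⟨⟨hs1, hs2⟩, ht1, ht2⟩
    refine hfU _ ?_
    dsimp only at *
    nlinarith [mul_nonneg (by linarith : 0 ≤ R / 2 - s) (by linarith : 0 ≤ R / 2 + s),
      mul_nonneg ht1 (by linarith : 0 ≤ R / 2 - t)]
  calc ENNReal.ofReal ((b - a) * R / (2 * U'))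
      = ENNReal.ofReal (1 / U') * volume T := by
        rw [hT, Measure.volume_eq_prod, Measure.prod_prod, Real.volume_Icc, Real.volume_Icc,
          ← ENNReal.ofReal_mul (by linarith), ← ENNReal.ofReal_mul (by positivity)]
        congr 1
        field_simp
        ring
    _ = ∫⁻ z in T, ENNReal.ofReal (1 / U') := by simp
    _ ≤ ∫⁻ z in T, f z := setLIntegral_mono hf hball
    _ = μ ((fun x => (v ⬝ᵥ x, v' ⬝ᵥ x)) ⁻¹' T) := by
        rw [← withDensity_apply _ hTm, ← hmap, Measure.map_apply
          ((measurable_dotProduct_left v).prodMk (measurable_dotProduct_left v')) hTm]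
    _ ≤ μ {x | v ⬝ᵥ x ∈ Set.Icc a b} := measure_mono fun x hx => hx.1

/-- Anti-anti-concentration bounds the second moment from below, hence the dimension. -/
theorem AntiAntiConcentrated.dim_le {μ : Measure (Fin d → ℝ)} [IsProbabilityMeasure μ]
    {U' R B2 : ℝ} (hA : AntiAntiConcentrated μ U' R) (hU' : 0 < U') (hd : 2 ≤ d) (hR : 0 < R)
    (hμ : ∀ᵐ x ∂μ, x ⬝ᵥ x ≤ B2) :
    (d : ℝ) ≤ 128 * U' / R ^ 4 * B2 := by
  have hi : ∀ i : Fin d, ENNReal.ofReal (R ^ 4 / (128 * U')) ≤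
      ∫⁻ x, ENNReal.ofReal (x i * x i) ∂μ := by
    intro i
    -- The slab `R/4 ≤ x i ≤ R/2` has mass at least `R² / (8 U')`, and on it `x i ^ 2 ≥ R² / 16`;
    -- Markov's inequality gives `R⁴ / (128 U')`.
    have h := hA.le_measure_slab hU' hd hR (v := Pi.single i 1) (by simp) (a := R / 4)
      (b := R / 2) (by linarith) (by linarith) le_rfl
    simp only [single_dotProduct, one_mul] at h
    calc ENNReal.ofReal (R ^ 4 / (128 * U'))
        = ENNReal.ofReal (R ^ 2 / 16) * ENNReal.ofReal ((R / 2 - R / 4) * R / (2 * U')) := by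
          rw [← ENNReal.ofReal_mul (by positivity)]
          congr 1
          field_simp
          ring
      _ ≤ ENNReal.ofReal (R ^ 2 / 16) *
          μ {x : Fin d → ℝ | ENNReal.ofReal (R ^ 2 / 16) ≤ ENNReal.ofReal (x i * x i)} := by
          gcongr
          refine h.trans (measure_mono fun x hx => ENNReal.ofReal_le_ofReal ?_)
          have := hx.1
          nlinarith
      _ ≤ _ := mul_meas_ge_le_lintegral (by fun_prop) _
  have hsum : ENNReal.ofReal (d * (R ^ 4 / (128 * U'))) ≤ ENNReal.ofReal B2 := by
    calc ENNReal.ofReal (d * (R ^ 4 / (128 * U')))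
        = ∑ _i : Fin d, ENNReal.ofReal (R ^ 4 / (128 * U')) := by
          rw [ENNReal.ofReal_mul (by positivity)]
          simp
      _ ≤ ∑ i : Fin d, ∫⁻ x, ENNReal.ofReal (x i * x i) ∂μ := Finset.sum_le_sum fun i _ => hi i
      _ = ∫⁻ x, ∑ i : Fin d, ENNReal.ofReal (x i * x i) ∂μ :=
          (lintegral_finsetSum _ fun i _ => by fun_prop).symm
      _ ≤ ∫⁻ _, ENNReal.ofReal B2 ∂μ := by
          refine lintegral_mono_ae ?_
          filter_upwards [hμ] with x hx
          rw [← ENNReal.ofReal_sum_of_nonneg fun i _ => mul_self_nonneg (x i)]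
          exact ENNReal.ofReal_le_ofReal hx
      _ = ENNReal.ofReal B2 := by simp
  have hpos : 0 < d * (R ^ 4 / (128 * U')) := by
    have : (0 : ℝ) < d := by exact_mod_cast (by omega : 0 < d)
    positivity
  have h : d * (R ^ 4 / (128 * U')) ≤ B2 := by
    rcases le_or_gt 0 B2 with h0 | h0
    · exact (ENNReal.ofReal_le_ofReal_iff h0).1 hsum
    · rw [ENNReal.ofReal_of_nonpos h0.le] at hsum
      exact absurd (ENNReal.ofReal_pos.2 hpos) (not_lt.2 hsum)
  calc (d : ℝ) = 128 * U' / R ^ 4 * (d * (R ^ 4 / (128 * U'))) := by field_simp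
    _ ≤ _ := by gcongr

end AdvHalfspace

/-! ### The cross-entropy loss -/

namespace AdvHalfspace

theorem one_add_exp_neg_pos (z : ℝ) : 0 < 1 + Real.exp (-z) := by positivity

theorem deriv_crossEntropy (z : ℝ) :
    deriv crossEntropy z = -(Real.exp (-z) / (1 + Real.exp (-z))) := by
  have h : HasDerivAt crossEntropy ((Real.exp (-z) * -1) / (1 + Real.exp (-z))) z :=
    (((hasDerivAt_neg z).exp).const_add 1).log (one_add_exp_neg_pos z).ne'
  rw [h.deriv]
  ring

theorem crossEntropy_nonneg (z : ℝ) : 0 ≤ crossEntropy z :=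
  Real.log_nonneg (by linarith [Real.exp_pos (-z)])

theorem crossEntropy_antitone : Antitone crossEntropy := fun a b h => by
  refine Real.log_le_log (one_add_exp_neg_pos b) ?_
  gcongr

theorem crossEntropy_le_exp (z : ℝ) : crossEntropy z ≤ Real.exp (-z) := by
  have := Real.log_le_sub_one_of_pos (one_add_exp_neg_pos z)
  unfold crossEntropy
  linarith

theorem crossEntropy_le_one_add (z : ℝ) {b : ℝ} (hb : 0 ≤ b) (hz : -b ≤ z) :
    crossEntropy z ≤ 1 + b := by
  refine (crossEntropy_antitone hz).trans ?_
  have h1 : 1 + Real.exp (- -b) ≤ 2 * Real.exp b := by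
    rw [neg_neg]
    linarith [Real.one_le_exp hb]
  refine (Real.log_le_log (one_add_exp_neg_pos _) h1).trans ?_
  rw [Real.log_mul (by norm_num) (Real.exp_pos _).ne', Real.log_exp]
  linarith [Real.log_two_lt_d9]

theorem half_le_crossEntropy {z : ℝ} (hz : z ≤ 0) : 1 / 2 ≤ crossEntropy z := by
  refine le_trans ?_ (crossEntropy_antitone hz)
  simp only [crossEntropy, neg_zero, Real.exp_zero]
  norm_num
  linarith [Real.log_two_gt_d9]

/-- With `s = -ℓ'(z) ∈ [0, 1]`, `s² ≤ s = 1 - (1 + exp (-z))⁻¹ ≤ log (1 + exp (-z))`. This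
self-bounding property lets the loss control the quadratic term of a gradient step. -/
theorem deriv_crossEntropy_sq_le (z : ℝ) : deriv crossEntropy z ^ 2 ≤ crossEntropy z := by
  have h0 := one_add_exp_neg_pos z
  have h1 := Real.one_sub_inv_le_log_of_pos h0
  have h2 : 1 - (1 + Real.exp (-z))⁻¹ = Real.exp (-z) / (1 + Real.exp (-z)) := by
    field_simp
    ring
  rw [h2] at h1
  rw [deriv_crossEntropy, neg_sq]
  have h3 : 0 ≤ Real.exp (-z) / (1 + Real.exp (-z)) := by positivity
  have h4 : Real.exp (-z) / (1 + Real.exp (-z)) ≤ 1 := by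
    rw [div_le_one h0]
    linarith
  exact le_trans (by nlinarith) h1

/-- The gradient inequality of the convex function `crossEntropy`. -/
theorem crossEntropy_gradient_inequality (a b : ℝ) :
    crossEntropy a + deriv crossEntropy a * (b - a) ≤ crossEntropy b := by
  have h0 := one_add_exp_neg_pos a
  set s := Real.exp (-a) / (1 + Real.exp (-a)) with hs
  have hs0 : 0 ≤ s := by positivity
  have hs1 : 0 ≤ 1 - s := by
    rw [sub_nonneg, hs, div_le_one h0]
    linarith
  -- Jensen for `exp` at the points `0` and `-(b - a)` with weights `1 - s` and `s`; the logarithm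
  -- of the result is the gradient inequality.
  have hj := convexOn_exp.2 (Set.mem_univ (0 : ℝ)) (Set.mem_univ (-(b - a))) hs1 hs0 (by ring)
  simp only [smul_eq_mul, mul_zero, zero_add, Real.exp_zero, mul_one] at hj
  have he : (1 - s) + s * Real.exp (-(b - a)) = (1 + Real.exp (-b)) / (1 + Real.exp (-a)) := by
    have : Real.exp (-b) = Real.exp (-a) * Real.exp (-(b - a)) := by
      rw [← Real.exp_add]; congr 1; ring
    rw [this, hs]
    field_simp
    ring
  rw [he] at hj
  have hl := (Real.le_log_iff_exp_le (div_pos (one_add_exp_neg_pos b) h0)).2 hj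
  rw [Real.log_div (one_add_exp_neg_pos b).ne' h0.ne'] at hl
  rw [deriv_crossEntropy, ← hs]
  unfold crossEntropy
  linarith

/-! ### Gradient descent on changing data -/

variable {d n : ℕ}

theorem sum_smul_dotProduct_self_le (c : Fin n → ℝ) (X : Fin n → Fin d → ℝ) {H : ℝ}
    (hX : ∀ i, X i ⬝ᵥ X i ≤ H) :
    (∑ i, c i • X i) ⬝ᵥ (∑ i, c i • X i) ≤ n * (H * ∑ i, c i ^ 2) := by
  have h : ∀ j ∈ (Finset.univ : Finset (Fin d)),
      (∑ i, c i • X i) j * (∑ i, c i • X i) j ≤ n * ∑ i, c i ^ 2 * (X i j * X i j) := by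
    intro j _
    have := sq_sum_le_card_mul_sum_sq (s := (Finset.univ : Finset (Fin n)))
      (f := fun i => c i * X i j)
    simp only [Finset.card_univ, Fintype.card_fin] at this
    simp only [Finset.sum_apply, Pi.smul_apply, smul_eq_mul]
    calc _ = (∑ i, c i * X i j) ^ 2 := by ring
      _ ≤ _ := this
      _ = _ := by congr 1; exact Finset.sum_congr rfl fun i _ => by ring
  refine (Finset.sum_le_sum h).trans ?_
  rw [← Finset.mul_sum, Finset.sum_comm, Finset.mul_sum]
  rw [Finset.mul_sum, Finset.mul_sum]
  refine Finset.sum_le_sum fun i _ => ?_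
  rw [← Finset.mul_sum, mul_comm H]
  exact mul_le_mul_of_nonneg_left (mul_le_mul_of_nonneg_left (hX i) (sq_nonneg _)) n.cast_nonneg

/-- Gradient descent on the cross-entropy loss, with data that may change in every step, reaches a
loss of at most twice the loss of any competitor `u` plus `ε` within `‖u‖² / (η ε)` steps. -/
theorem exists_iterate_loss_le (X : ℕ → Fin n → Fin d → ℝ) (y : Fin n → ℝ)
    (hy : ∀ i, y i ^ 2 = 1) {H η ε b : ℝ} (hX : ∀ k i, X k i ⬝ᵥ X k i ≤ H) (hη : 0 < η)
    (hηH : η * H ≤ 1) (hε : 0 < ε) (hn : 0 < n) (w : ℕ → Fin d → ℝ) (hw0 : w 0 = 0)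
    (hw : ∀ k, w (k + 1) = w k - (η / n) • ∑ i,
      (deriv crossEntropy (y i * (w k ⬝ᵥ X k i)) * y i) • X k i)
    (u : Fin d → ℝ) (hu : ∀ k, ∑ i, crossEntropy (y i * (u ⬝ᵥ X k i)) ≤ n * b) :
    ∃ k : ℕ, (k : ℝ) ≤ (u ⬝ᵥ u) / (η * ε) ∧
      ∑ i, crossEntropy (y i * (w k ⬝ᵥ X k i)) ≤ n * (2 * b + ε) := by
  have hn' : (0 : ℝ) < n := by exact_mod_cast hn
  set a : ℕ → ℝ := fun k => ∑ i, crossEntropy (y i * (w k ⬝ᵥ X k i)) with ha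
  have ha0 : ∀ k, 0 ≤ a k := fun k => Finset.sum_nonneg fun i _ => crossEntropy_nonneg _
  -- Expanding the square, the linear term is at most `-2 η (a k / n - b)` by convexity, and the
  -- quadratic term at most `η (a k / n)` by self-bounding and `η H ≤ 1`. Half of the gain survives,
  -- whence the `2 b` in the conclusion.
  have step : ∀ k, (w (k + 1) - u) ⬝ᵥ (w (k + 1) - u) ≤
      (w k - u) ⬝ᵥ (w k - u) - η * (a k / n) + 2 * η * b := by
    intro k
    set c : Fin n → ℝ := fun i => deriv crossEntropy (y i * (w k ⬝ᵥ X k i)) * y i with hc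
    set g := ∑ i, c i • X k i with hg
    have e1 : w (k + 1) - u = (w k - u) - (η / n) • g := by
      rw [hw k]
      abel
    have hgg : g ⬝ᵥ g ≤ n * (H * a k) := by
      rcases isEmpty_or_nonempty (Fin n) with h | ⟨⟨i0⟩⟩
      · simp [hg, ha]
      have hH : 0 ≤ H := (dotProduct_self_nonneg' (X 0 i0)).trans (hX 0 i0)
      refine (sum_smul_dotProduct_self_le c (X k) (hX k)).trans ?_
      gcongr
      refine Finset.sum_le_sum fun i _ => ?_
      rw [mul_pow, hy i, mul_one]
      exact deriv_crossEntropy_sq_le _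
    have hlin : a k - n * b ≤ (w k - u) ⬝ᵥ g := by
      have : (w k - u) ⬝ᵥ g = ∑ i, c i * ((w k - u) ⬝ᵥ X k i) := by
        rw [hg, dotProduct_sum]
        simp [dotProduct_smul]
      rw [this]
      refine le_trans (sub_le_sub_left (hu k) _) ?_
      rw [ha]
      dsimp only
      rw [← Finset.sum_sub_distrib]
      refine Finset.sum_le_sum fun i _ => ?_
      have := crossEntropy_gradient_inequality (y i * (w k ⬝ᵥ X k i)) (y i * (u ⬝ᵥ X k i))
      rw [hc, sub_dotProduct]
      dsimp only
      linarith
    rw [e1]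
    have e2 : ((w k - u) - (η / n) • g) ⬝ᵥ ((w k - u) - (η / n) • g) =
        (w k - u) ⬝ᵥ (w k - u) - 2 * (η / n) * ((w k - u) ⬝ᵥ g) + (η / n) ^ 2 * (g ⬝ᵥ g) := by
      generalize w k - u = z
      simp only [sub_dotProduct, dotProduct_sub, smul_dotProduct, dotProduct_smul, smul_eq_mul]
      rw [dotProduct_comm g z]
      ring
    rw [e2]
    have e3 : (η / n) ^ 2 * (g ⬝ᵥ g) ≤ η * (a k / n) := by
      calc (η / n) ^ 2 * (g ⬝ᵥ g) ≤ (η / n) ^ 2 * (n * (H * a k)) := by gcongr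
        _ = (η * H) * (η * (a k / n)) := by field_simp
        _ ≤ 1 * (η * (a k / n)) := by
          have := ha0 k
          gcongr
        _ = _ := one_mul _
    have e4 : 2 * (η / n) * (a k - n * b) ≤ 2 * (η / n) * ((w k - u) ⬝ᵥ g) := by gcongr
    have e5 : 2 * (η / n) * (a k - n * b) = 2 * (η * (a k / n)) - 2 * η * b := by
      field_simp
    linarith
  by_contra! hcon
  -- As long as `a K / n > 2 b + ε`, each step lowers the squared distance to `u` by at least `η ε`.
  -- The range reaches one step beyond `‖u‖² / (η ε)`, where the squared distance would be negative.
  have hdec : ∀ K : ℕ, (K : ℝ) ≤ (u ⬝ᵥ u) / (η * ε) + 1 →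
      (w K - u) ⬝ᵥ (w K - u) ≤ u ⬝ᵥ u - η * ε * K := by
    intro K
    induction K with
    | zero => intro _; simp [hw0]
    | succ K ih =>
      intro hK
      push_cast at hK ⊢
      have h1 := ih (by linarith)
      have h2 := hcon K (by linarith)
      have h3 : 2 * b + ε < a K / n := by
        rw [lt_div_iff₀ hn', mul_comm]
        exact h2
      have h4 := step K
      nlinarith
  set t := (u ⬝ᵥ u) / (η * ε) with ht
  have ht0 : 0 ≤ t := div_nonneg (dotProduct_self_nonneg' u) (by positivity)
  have hK := hdec (⌊t⌋₊ + 1) (by push_cast; linarith [Nat.floor_le ht0])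
  have hlt := Nat.lt_floor_add_one t
  have : u ⬝ᵥ u = η * ε * t := by rw [ht]; field_simp
  have hpos := dotProduct_self_nonneg' (w (⌊t⌋₊ + 1) - u)
  push_cast at hK
  have h5 : η * ε * t < η * ε * (⌊t⌋₊ + 1) := by gcongr
  linarith

end AdvHalfspace

/-! ### Robust and standard error under the distribution -/

namespace AdvHalfspace

theorem measureReal_mono_ae {Z : Type*} [MeasurableSpace Z] {D : Measure Z} [IsFiniteMeasure D]
    {s t : Set Z} (h : ∀ᵐ z ∂D, z ∈ s → z ∈ t) : D.real s ≤ D.real t :=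
  ENNReal.toReal_mono (measure_ne_top D t) (measure_mono_ae h)

theorem sign_ne_iff {y t : ℝ} (hy : y = 1 ∨ y = -1) : Real.sign t ≠ y ↔ y * t ≤ 0 := by
  rcases lt_trichotomy t 0 with ht | rfl | ht
  · rw [Real.sign_of_neg ht]
    rcases hy with rfl | rfl <;> norm_num <;> linarith
  · rcases hy with rfl | rfl <;> norm_num
  · rw [Real.sign_of_pos ht]
    rcases hy with rfl | rfl <;> norm_num <;> linarith

theorem sign_mul_of_pos {c : ℝ} (hc : 0 < c) (t : ℝ) : Real.sign (c * t) = Real.sign t := by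
  rcases lt_trichotomy t 0 with ht | rfl | ht
  · rw [Real.sign_of_neg ht, Real.sign_of_neg (mul_neg_of_pos_of_neg hc ht)]
  · simp
  · rw [Real.sign_of_pos ht, Real.sign_of_pos (mul_pos hc ht)]

variable {d : ℕ} {D : Measure ((Fin d → ℝ) × ℝ)}

theorem robustError_smul (p : ℝ≥0∞) (r : ℝ) {c : ℝ} (hc : 0 < c) (w : Fin d → ℝ) :
    robustError D p r (c • w) = robustError D p r w := by
  simp only [robustError, smul_dotProduct, smul_eq_mul, sign_mul_of_pos hc]

theorem exists_unit_smul {w : Fin d → ℝ} (hw : w ≠ 0) :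
    ∃ (c : ℝ) (v : Fin d → ℝ), 0 < c ∧ w = c • v ∧ v ⬝ᵥ v = 1 := by
  have h0 : 0 < w ⬝ᵥ w := lt_of_le_of_ne (dotProduct_self_nonneg' w)
    (fun h => hw (dotProduct_self_eq_zero.1 h.symm))
  have hc : 0 < √(w ⬝ᵥ w) := Real.sqrt_pos.2 h0
  refine ⟨√(w ⬝ᵥ w), (√(w ⬝ᵥ w))⁻¹ • w, hc, ?_, ?_⟩
  · rw [smul_smul, mul_inv_cancel₀ hc.ne', one_smul]
  · rw [smul_dotProduct, dotProduct_smul, smul_eq_mul, smul_eq_mul, ← mul_assoc, ← mul_inv,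
      Real.mul_self_sqrt h0.le, inv_mul_cancel₀ h0.ne']

theorem abs_dotProduct_le {v x : Fin d → ℝ} {a b : ℝ} (ha : 0 ≤ a) (hb : 0 ≤ b)
    (hv : v ⬝ᵥ v ≤ a ^ 2) (hx : x ⬝ᵥ x ≤ b ^ 2) : |v ⬝ᵥ x| ≤ a * b := by
  refine abs_le_of_sq_le_sq ?_ (by positivity)
  calc (v ⬝ᵥ x) ^ 2 ≤ (v ⬝ᵥ v) * (x ⬝ᵥ x) := dotProduct_sq_le v x
    _ ≤ a ^ 2 * b ^ 2 := mul_le_mul hv hx (dotProduct_self_nonneg' x) (by positivity)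
    _ = (a * b) ^ 2 := by ring

theorem measurable_fst_dotProduct (v : Fin d → ℝ) :
    Measurable fun z : (Fin d → ℝ) × ℝ => v ⬝ᵥ z.1 :=
  (measurable_dotProduct_left v).comp measurable_fst

theorem map_fst_dotProduct (v : Fin d → ℝ) :
    D.map (fun z => v ⬝ᵥ z.1) = D.fst.map (fun x => v ⬝ᵥ x) := by
  rw [Measure.fst, Measure.map_map (measurable_dotProduct_left v) measurable_fst]
  rfl

theorem measureReal_abs_dotProduct_le {A : ℝ} (hA0 : 0 ≤ A) {v : Fin d → ℝ}
    (hv : D.map (fun z => v ⬝ᵥ z.1) ≤ ENNReal.ofReal A • volume) {c : ℝ} (hc : 0 ≤ c) :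
    D.real {z | |v ⬝ᵥ z.1| ≤ c} ≤ A * (2 * c) := by
  have h := hv (Set.Icc (-c) c)
  rw [Measure.map_apply (measurable_fst_dotProduct v) measurableSet_Icc] at h
  have h2 : D {z | |v ⬝ᵥ z.1| ≤ c} ≤ ENNReal.ofReal (A * (2 * c)) := by
    refine (measure_mono fun z hz => ?_).trans (h.trans (le_of_eq ?_))
    · exact abs_le.1 hz
    · simp only [Measure.smul_apply, Real.volume_Icc, smul_eq_mul]
      rw [← ENNReal.ofReal_mul hA0]
      congr 1; ring
  exact ENNReal.toReal_le_of_le_ofReal (by positivity) h2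

/-- A density of at most `A` allows comparison with Lebesgue measure, under which `exp (-|s| / ε)`
has integral `2 ε`. -/
theorem integral_exp_neg_abs_dotProduct_le {A : ℝ} (hA0 : 0 ≤ A) {v : Fin d → ℝ}
    (hv : D.map (fun z => v ⬝ᵥ z.1) ≤ ENNReal.ofReal A • volume) {ε : ℝ} (hε : 0 < ε) :
    ∫ z, Real.exp (-(|v ⬝ᵥ z.1| / ε)) ∂D ≤ A * (2 * ε) := by
  have hval : ∫ s : ℝ, Real.exp (-(|s| / ε)) = 2 * ε := by
    rw [integral_comp_abs (f := fun s => Real.exp (-(s / ε)))]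
    have := integral_exp_mul_Ioi (a := -(1 / ε)) (by simpa using hε) 0
    have e : (fun s : ℝ => Real.exp (-(s / ε))) = fun s => Real.exp (-(1 / ε) * s) := by
      ext s; congr 1; ring
    rw [e, this]
    simp
  have hint : Integrable fun s : ℝ => Real.exp (-(|s| / ε)) :=
    Integrable.of_integral_ne_zero (by rw [hval]; positivity)
  have hm : Measurable fun s : ℝ => Real.exp (-(|s| / ε)) := by fun_prop
  calc ∫ z, Real.exp (-(|v ⬝ᵥ z.1| / ε)) ∂D
      = ∫ s, Real.exp (-(|s| / ε)) ∂(D.map fun z => v ⬝ᵥ z.1) :=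
        (integral_map (measurable_fst_dotProduct v).aemeasurable hm.aestronglyMeasurable).symm
    _ ≤ ∫ s, Real.exp (-(|s| / ε)) ∂(ENNReal.ofReal A • volume) :=
        integral_mono_measure hv (Filter.Eventually.of_forall fun s => (Real.exp_pos _).le)
          (hint.smul_measure ENNReal.ofReal_ne_top)
    _ = A * (2 * ε) := by
        rw [integral_smul_measure, hval, ENNReal.toReal_ofReal hA0, smul_eq_mul]

section Population

variable [IsProbabilityMeasure D]

/-- The mass near the decision boundary, where every halfspace errs, bounds the robust error from
below. -/
theorem le_robustError {p : ℝ≥0∞} (hp : 2 ≤ p) {r R U' : ℝ} (hr : 0 ≤ r) (hrR : r ≤ R)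
    (hR : 0 < R) (hU' : 0 < U') (hd : 2 ≤ d) (hy : ∀ᵐ z ∂D, z.2 = 1 ∨ z.2 = -1)
    (hA : AntiAntiConcentrated D.fst U' R) {w : Fin d → ℝ} (hw : w ≠ 0) :
    r * R / (2 * U') ≤ robustError D p r w := by
  obtain ⟨c, v, hc, rfl, hv⟩ := exists_unit_smul hw
  rw [robustError_smul p r hc]
  -- Half-width `r / 2` instead of `r` keeps the slab within the range `R / 2` in which its mass is
  -- controlled.
  have h := hA.le_measure_slab hU' hd hR hv (a := -(r / 2)) (b := r / 2) (by linarith)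
    (by linarith) (by linarith)
  have hm : MeasurableSet {x : Fin d → ℝ | v ⬝ᵥ x ∈ Set.Icc (-(r / 2)) (r / 2)} :=
    measurable_dotProduct_left v measurableSet_Icc
  rw [Measure.fst_apply hm] at h
  have h2 : D.real (Prod.fst ⁻¹' {x : Fin d → ℝ | v ⬝ᵥ x ∈ Set.Icc (-(r / 2)) (r / 2)}) ≤
      robustError D p r v := by
    refine measureReal_mono_ae ?_
    filter_upwards [hy] with z hz hzs
    -- The adversarial point is the orthogonal projection to the decision boundary, where the tie is
    -- an error.
    refine ⟨z.1 - (v ⬝ᵥ z.1) • v, ?_, ?_⟩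
    · refine (vecNorm_le_sqrt_dotProduct hp _).trans ?_
      have e : (z.1 - (v ⬝ᵥ z.1) • v - z.1) ⬝ᵥ (z.1 - (v ⬝ᵥ z.1) • v - z.1) =
          (v ⬝ᵥ z.1) ^ 2 := by
        have : z.1 - (v ⬝ᵥ z.1) • v - z.1 = -((v ⬝ᵥ z.1) • v) := by abel
        rw [this, neg_dotProduct_neg, smul_dotProduct, dotProduct_smul, hv]
        simp [sq]
      rw [e, Real.sqrt_sq_eq_abs]
      exact (abs_le.2 hzs).trans (by linarith)
    · have e : v ⬝ᵥ (z.1 - (v ⬝ᵥ z.1) • v) = 0 := by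
        rw [dotProduct_sub, dotProduct_smul, hv]
        simp
      rw [sign_ne_iff hz, e, mul_zero]
  refine le_trans ?_ h2
  refine (ENNReal.ofReal_le_iff_le_toReal (measure_ne_top D _)).1 (le_trans (le_of_eq ?_) h)
  congr 1; ring

theorem measureReal_nonpos_le_robustError {p : ℝ≥0∞} (hp : 2 ≤ p) {r : ℝ} (hr : 0 ≤ r)
    (hy : ∀ᵐ z ∂D, z.2 = 1 ∨ z.2 = -1) (w : Fin d → ℝ) :
    D.real {z | z.2 * (w ⬝ᵥ z.1) ≤ 0} ≤ robustError D p r w := by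
  refine measureReal_mono_ae ?_
  filter_upwards [hy] with z hz hzs
  refine ⟨z.1, ?_, (sign_ne_iff hz).2 hzs⟩
  rw [sub_self, vecNorm_zero p (le_trans (by norm_num) hp)]
  exact hr

/-- By Cauchy–Schwarz a perturbation changes the margin of a unit vector by at most `b`. -/
theorem robustError_le_measureReal {p : ℝ≥0∞} {r b : ℝ} (hb : 0 ≤ b)
    (hpert : ∀ δ : Fin d → ℝ, vecNorm p δ ≤ r → δ ⬝ᵥ δ ≤ b ^ 2)
    (hy : ∀ᵐ z ∂D, z.2 = 1 ∨ z.2 = -1) {v : Fin d → ℝ} (hv : v ⬝ᵥ v = 1) :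
    robustError D p r v ≤ D.real {z | z.2 * (v ⬝ᵥ z.1) ≤ b} := by
  refine measureReal_mono_ae ?_
  filter_upwards [hy] with z hz hzs
  obtain ⟨x', hx', hs⟩ := hzs
  rw [sign_ne_iff hz] at hs
  have h1 := abs_dotProduct_le (v := v) (a := 1) zero_le_one hb (by rw [hv]; norm_num)
    (hpert _ hx')
  have h2 : v ⬝ᵥ x' = v ⬝ᵥ z.1 + v ⬝ᵥ (x' - z.1) := by rw [dotProduct_sub]; ring
  rw [h2] at hs
  show z.2 * (v ⬝ᵥ z.1) ≤ b
  rw [one_mul, abs_le] at h1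
  rcases hz with h | h <;> rw [h] at hs ⊢ <;> linarith

end Population

end AdvHalfspace

/-! ### Uniform convergence over a grid of halfspaces -/

namespace AdvHalfspace

variable {d n : ℕ} {D : Measure ((Fin d → ℝ) × ℝ)}

/-- The vectors in `[-1, 1]^d` whose coordinates are multiples of `1 / N`. -/
noncomputable def gridVector (N : ℕ) (j : Fin d → Fin (2 * N + 1)) : Fin d → ℝ :=
  fun i => ((j i : ℕ) - N : ℝ) / N

theorem exists_gridVector {N : ℕ} (hN : 0 < N) {w : Fin d → ℝ} (hw : ∀ i, |w i| ≤ 1) :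
    ∃ j : Fin d → Fin (2 * N + 1), ∀ i, |w i - gridVector N j i| ≤ 1 / N := by
  have hN' : (0 : ℝ) < N := by exact_mod_cast hN
  have h0 : ∀ i, 0 ≤ (w i + 1) * N := fun i => by
    have := (abs_le.1 (hw i)).1
    exact mul_nonneg (by linarith) hN'.le
  have hlt : ∀ i, ⌊(w i + 1) * N⌋₊ < 2 * N + 1 := fun i => by
    have h2 : (w i + 1) * N ≤ ((2 * N : ℕ) : ℝ) := by
      push_cast
      have := (abs_le.1 (hw i)).2
      nlinarith
    exact Nat.lt_succ_of_le (Nat.floor_le_of_le h2)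
  refine ⟨fun i => ⟨_, hlt i⟩, fun i => ?_⟩
  have h1 := Nat.floor_le (h0 i)
  have h2 := Nat.lt_floor_add_one ((w i + 1) * N)
  have e : w i - gridVector N (fun i => ⟨_, hlt i⟩) i = ((w i + 1) * N - ⌊(w i + 1) * N⌋₊) / N := by
    simp only [gridVector]
    field_simp
    ring
  rw [e, abs_of_nonneg (div_nonneg (by linarith) hN'.le)]
  gcongr
  linarith

theorem abs_dotProduct_sub_le {v w x : Fin d → ℝ} {h : ℝ} (hvw : ∀ i, |v i - w i| ≤ h)
    (hx : ∀ i, |x i| ≤ 1) : |v ⬝ᵥ x - w ⬝ᵥ x| ≤ d * h := by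
  rw [← sub_dotProduct]
  refine (Finset.abs_sum_le_sum_abs _ _).trans ?_
  have : ∀ i ∈ (Finset.univ : Finset (Fin d)), |(v - w) i * x i| ≤ h := fun i _ => by
    rw [abs_mul, Pi.sub_apply]
    have h1 := hvw i
    exact (mul_le_of_le_one_right (abs_nonneg _) (hx i)).trans h1
  simpa using Finset.sum_le_card_nsmul _ _ _ this

/-- The indicator function of the event that `w` classifies correctly up to a slack `ρ`. -/
noncomputable def slackIndicator (w : Fin d → ℝ) (ρ : ℝ) : (Fin d → ℝ) × ℝ → ℝ :=
  Set.indicator {z | -ρ < z.2 * (w ⬝ᵥ z.1)} 1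

theorem measurableSet_slack (w : Fin d → ℝ) (ρ : ℝ) :
    MeasurableSet {z : (Fin d → ℝ) × ℝ | -ρ < z.2 * (w ⬝ᵥ z.1)} :=
  measurableSet_lt measurable_const (measurable_snd.mul (measurable_fst_dotProduct w))

theorem measurable_slackIndicator (w : Fin d → ℝ) (ρ : ℝ) : Measurable (slackIndicator w ρ) :=
  measurable_one.indicator (measurableSet_slack w ρ)

theorem slackIndicator_mem_Icc (w : Fin d → ℝ) (ρ : ℝ) (z : (Fin d → ℝ) × ℝ) :
    slackIndicator w ρ z ∈ Set.Icc (0 : ℝ) 1 := by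
  unfold slackIndicator
  by_cases h : z ∈ {z : (Fin d → ℝ) × ℝ | -ρ < z.2 * (w ⬝ᵥ z.1)}
  · simp [Set.indicator_of_mem h]
  · simp [Set.indicator_of_notMem h]

variable [IsProbabilityMeasure D]

theorem integral_slackIndicator (w : Fin d → ℝ) (ρ : ℝ) :
    ∫ z, slackIndicator w ρ z ∂D = 1 - D.real {z | z.2 * (w ⬝ᵥ z.1) ≤ -ρ} := by
  have hc : {z : (Fin d → ℝ) × ℝ | z.2 * (w ⬝ᵥ z.1) ≤ -ρ} =
      {z | -ρ < z.2 * (w ⬝ᵥ z.1)}ᶜ := by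
    ext z; simp
  rw [hc, probReal_compl_eq_one_sub (measurableSet_slack w ρ)]
  unfold slackIndicator
  rw [integral_indicator_one (measurableSet_slack w ρ)]
  ring

/-- Uniform convergence over the grid. -/
theorem measure_pi_grid_le {N : ℕ} (ρ : ℝ) {t : ℝ} (ht : 0 ≤ t) (n : ℕ) :
    (Measure.pi fun _ : Fin n => D)
      {S | ¬ ∀ j : Fin d → Fin (2 * N + 1), ∑ i, slackIndicator (gridVector N j) ρ (S i) <
        n * (∫ z, slackIndicator (gridVector N j) ρ z ∂D + t)} ≤
      ENNReal.ofReal ((2 * N + 1) ^ d * Real.exp (-(2 * n * t ^ 2))) := by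
  have hsub : {S : Fin n → (Fin d → ℝ) × ℝ | ¬ ∀ j : Fin d → Fin (2 * N + 1),
      ∑ i, slackIndicator (gridVector N j) ρ (S i) <
        n * (∫ z, slackIndicator (gridVector N j) ρ z ∂D + t)} ⊆
      ⋃ j : Fin d → Fin (2 * N + 1), {S | n * (∫ z, slackIndicator (gridVector N j) ρ z ∂D + t) ≤
        ∑ i, slackIndicator (gridVector N j) ρ (S i)} := by
    intro S hS
    have hS' : ¬ ∀ j : Fin d → Fin (2 * N + 1), ∑ i, slackIndicator (gridVector N j) ρ (S i) <
        n * (∫ z, slackIndicator (gridVector N j) ρ z ∂D + t) := hS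
    push Not at hS'
    exact Set.mem_iUnion.2 hS'
  refine (measure_mono hsub).trans ((measure_iUnion_fintype_le _ _).trans ?_)
  have h := fun j : Fin d → Fin (2 * N + 1) => measure_pi_sum_ge_le D
    (measurable_slackIndicator (gridVector N j) ρ) (slackIndicator_mem_Icc _ ρ) ht n
  refine (Finset.sum_le_sum fun j _ => h j).trans (le_of_eq ?_)
  rw [ENNReal.ofReal_mul (by positivity)]
  simp only [one_pow, div_one, Finset.sum_const, Finset.card_univ, Fintype.card_fun,
    Fintype.card_fin, nsmul_eq_mul]
  congr 1
  rw [← ENNReal.ofReal_natCast]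
  push_cast
  rfl

/-- If the empirical frequencies of the grid halfspaces are close to their probabilities, then the
robust error of every halfspace is bounded in terms of its empirical (standard) error. -/
theorem robustError_le_empirical {p : ℝ≥0∞} {r b A t : ℝ} {N : ℕ} (hN : 0 < N) (hb : 0 ≤ b)
    (hA0 : 0 ≤ A) (ht : 0 ≤ t) (hpert : ∀ δ : Fin d → ℝ, vecNorm p δ ≤ r → δ ⬝ᵥ δ ≤ b ^ 2)
    (hy : ∀ᵐ z ∂D, z.2 = 1 ∨ z.2 = -1) (hx : ∀ᵐ z ∂D, ∀ i, |z.1 i| ≤ 1)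
    (hA : ∀ v : Fin d → ℝ, v ⬝ᵥ v = 1 →
      D.map (fun z => v ⬝ᵥ z.1) ≤ ENNReal.ofReal A • volume)
    {S : Fin n → (Fin d → ℝ) × ℝ} (hyS : ∀ i, (S i).2 = 1 ∨ (S i).2 = -1)
    (hxS : ∀ i l, |(S i).1 l| ≤ 1)
    (hgood : ∀ j : Fin d → Fin (2 * N + 1),
      ∑ i, slackIndicator (gridVector N j) (d * (1 / N)) (S i) <
        n * (∫ z, slackIndicator (gridVector N j) (d * (1 / N)) z ∂D + t))
    (w : Fin d → ℝ) :
    n * robustError D p r w ≤ (∑ i, if (S i).2 * (w ⬝ᵥ (S i).1) ≤ 0 then (1 : ℝ) else 0) +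
      n * (t + A * (2 * (2 * (d * (1 / N)) + b))) := by
  set ρ : ℝ := d * (1 / N) with hρ
  have hρ0 : 0 ≤ ρ := by positivity
  -- The zero vector ties on every sample point, so its empirical error is already `1`.
  rcases eq_or_ne w 0 with rfl | hw
  · have h1 : robustError D p r 0 ≤ 1 := measureReal_le_one
    have h2 : 0 ≤ t + A * (2 * (2 * ρ + b)) := by positivity
    simp only [zero_dotProduct, mul_zero, le_refl, if_true, Finset.sum_const, Finset.card_univ,
      Fintype.card_fin, nsmul_eq_mul]
    nlinarith [mul_nonneg (n.cast_nonneg (α := ℝ)) h2, mul_nonneg (n.cast_nonneg (α := ℝ))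
      (sub_nonneg.2 h1)]
  obtain ⟨c, v, hc, rfl, hv⟩ := exists_unit_smul hw
  have he : ∀ i, ((S i).2 * ((c • v) ⬝ᵥ (S i).1) ≤ 0) = ((S i).2 * (v ⬝ᵥ (S i).1) ≤ 0) := by
    intro i
    have : (S i).2 * ((c • v) ⬝ᵥ (S i).1) = c * ((S i).2 * (v ⬝ᵥ (S i).1)) := by
      rw [smul_dotProduct, smul_eq_mul]; ring
    rw [this, mul_nonpos_iff_pos_imp_nonpos]
    exact propext ⟨fun h => h.1 hc, fun h => ⟨fun _ => h, fun h' => hc.le⟩⟩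
  simp only [he]
  rw [robustError_smul p r hc]
  have hv1 : ∀ i, |v i| ≤ 1 := fun i => by
    rw [abs_le_one_iff_mul_self_le_one, ← hv]
    exact Finset.single_le_sum (f := fun i => v i * v i) (fun i _ => mul_self_nonneg (v i))
      (Finset.mem_univ i)
  obtain ⟨j, hj⟩ := exists_gridVector hN hv1
  set v' := gridVector N j with hv'
  have hclose : ∀ x : Fin d → ℝ, (∀ i, |x i| ≤ 1) → |v ⬝ᵥ x - v' ⬝ᵥ x| ≤ ρ := fun x hx =>
    abs_dotProduct_sub_le hj hx
  -- If the margin under `v` is at most `b` but that under `v'` exceeds `-ρ`, then the former lies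
  -- in `[-2 ρ, b]`: the point is in a thin slab, whose mass is `O(2 ρ + b)`.
  have hpop : robustError D p r v ≤ D.real {z | z.2 * (v' ⬝ᵥ z.1) ≤ -ρ} +
      A * (2 * (2 * ρ + b)) := by
    refine (robustError_le_measureReal hb hpert hy hv).trans ?_
    refine le_trans ?_ (add_le_add le_rfl
      (measureReal_abs_dotProduct_le hA0 (hA v hv) (c := 2 * ρ + b) (by positivity)))
    refine le_trans (measureReal_mono_ae ?_) (measureReal_union_le _ _)
    filter_upwards [hx, hy] with z hxz hyz hz
    have hz' : z.2 * (v ⬝ᵥ z.1) ≤ b := hz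
    have hcl := abs_le.1 (hclose z.1 hxz)
    by_cases hcase : z.2 * (v' ⬝ᵥ z.1) ≤ -ρ
    · exact Or.inl hcase
    · refine Or.inr ?_
      show |v ⬝ᵥ z.1| ≤ 2 * ρ + b
      rw [abs_le]
      rcases hyz with h | h <;> rw [h] at hz' hcase <;> constructor <;> linarith
  -- On the sample the slack `ρ` absorbs the grid error: whatever `v` classifies correctly has
  -- margin above `-ρ` under `v'`.
  have hemp : (n : ℝ) - ∑ i, (if (S i).2 * (v ⬝ᵥ (S i).1) ≤ 0 then (1 : ℝ) else 0) ≤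
      ∑ i, slackIndicator v' ρ (S i) := by
    have : (n : ℝ) = ∑ _i : Fin n, (1 : ℝ) := by simp
    rw [this, ← Finset.sum_sub_distrib]
    refine Finset.sum_le_sum fun i _ => ?_
    split_ifs with h
    · simpa using (slackIndicator_mem_Icc v' ρ (S i)).1
    · have hmem : S i ∈ {z : (Fin d → ℝ) × ℝ | -ρ < z.2 * (v' ⬝ᵥ z.1)} := by
        have hcl := abs_le.1 (hclose (S i).1 (hxS i))
        show -ρ < (S i).2 * (v' ⬝ᵥ (S i).1)
        push Not at h
        rcases hyS i with h1 | h1 <;> rw [h1] at h ⊢ <;> linarith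
      simp [slackIndicator, Set.indicator_of_mem hmem]
  have hg := hgood j
  rw [integral_slackIndicator] at hg
  have := mul_le_mul_of_nonneg_left hpop (n.cast_nonneg (α := ℝ))
  linarith

end AdvHalfspace

/-! ### The competitor and the empirical error of an iterate -/

namespace AdvHalfspace

variable {d n : ℕ} {D : Measure ((Fin d → ℝ) × ℝ)}

/-- An upper bound for the adversarial cross-entropy loss of `ε⁻¹ • v`, for a unit vector `v`. -/
noncomputable def competitorLoss (v : Fin d → ℝ) (κ B ε : ℝ) (z : (Fin d → ℝ) × ℝ) : ℝ :=
  Real.exp κ * Real.exp (-(|v ⬝ᵥ z.1| / ε)) +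
    (1 + 2 * B / ε) * Set.indicator {z : (Fin d → ℝ) × ℝ | z.2 * (v ⬝ᵥ z.1) ≤ 0} 1 z

theorem measurableSet_nonpos (v : Fin d → ℝ) :
    MeasurableSet {z : (Fin d → ℝ) × ℝ | z.2 * (v ⬝ᵥ z.1) ≤ 0} :=
  measurableSet_le (measurable_snd.mul (measurable_fst_dotProduct v)) measurable_const

theorem measurable_exp_neg_abs (v : Fin d → ℝ) (ε : ℝ) :
    Measurable fun z : (Fin d → ℝ) × ℝ => Real.exp (-(|v ⬝ᵥ z.1| / ε)) := by
  have h : Measurable fun s : ℝ => Real.exp (-(|s| / ε)) := by fun_prop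
  exact h.comp (measurable_fst_dotProduct v)

theorem measurable_competitorLoss (v : Fin d → ℝ) (κ B ε : ℝ) :
    Measurable (competitorLoss v κ B ε) :=
  ((measurable_exp_neg_abs v ε).const_mul _).add
    ((measurable_one.indicator (measurableSet_nonpos v)).const_mul _)

theorem exp_neg_abs_mem_Icc (s : ℝ) {ε : ℝ} (hε : 0 < ε) :
    Real.exp (-(|s| / ε)) ∈ Set.Icc (0 : ℝ) 1 := by
  refine ⟨(Real.exp_pos _).le, Real.exp_le_one_iff.2 ?_⟩
  have : 0 ≤ |s| / ε := by positivity
  linarith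

theorem competitorLoss_mem_Icc (v : Fin d → ℝ) (κ : ℝ) {B ε : ℝ} (hB : 0 ≤ B) (hε : 0 < ε)
    (z : (Fin d → ℝ) × ℝ) :
    competitorLoss v κ B ε z ∈ Set.Icc 0 (Real.exp κ + (1 + 2 * B / ε)) := by
  have h1 := exp_neg_abs_mem_Icc (v ⬝ᵥ z.1) hε
  have h2 : Set.indicator {z : (Fin d → ℝ) × ℝ | z.2 * (v ⬝ᵥ z.1) ≤ 0} (1 : (Fin d → ℝ) × ℝ → ℝ) z ∈
      Set.Icc (0 : ℝ) 1 := by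
    by_cases h : z ∈ {z : (Fin d → ℝ) × ℝ | z.2 * (v ⬝ᵥ z.1) ≤ 0}
    · simp [Set.indicator_of_mem h]
    · simp [Set.indicator_of_notMem h]
  have h3 : 0 ≤ 1 + 2 * B / ε := by positivity
  have h4 := (Real.exp_pos κ).le
  exact ⟨add_nonneg (mul_nonneg h4 h1.1) (mul_nonneg h3 h2.1),
    add_le_add (mul_le_of_le_one_right h4 h1.2) (mul_le_of_le_one_right h3 h2.2)⟩

theorem integral_competitorLoss_le [IsProbabilityMeasure D] {A : ℝ} (hA0 : 0 ≤ A)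
    {v : Fin d → ℝ} (hv : D.map (fun z => v ⬝ᵥ z.1) ≤ ENNReal.ofReal A • volume) (κ B : ℝ)
    {ε : ℝ} (hε : 0 < ε) :
    ∫ z, competitorLoss v κ B ε z ∂D ≤
      Real.exp κ * (A * (2 * ε)) + (1 + 2 * B / ε) * D.real {z | z.2 * (v ⬝ᵥ z.1) ≤ 0} := by
  have hi : Integrable (fun z : (Fin d → ℝ) × ℝ => Real.exp (-(|v ⬝ᵥ z.1| / ε))) D :=
    Integrable.of_mem_Icc 0 1 (measurable_exp_neg_abs v ε).aemeasurable
      (Filter.Eventually.of_forall fun z => exp_neg_abs_mem_Icc _ hε)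
  have hj : Integrable (Set.indicator {z : (Fin d → ℝ) × ℝ | z.2 * (v ⬝ᵥ z.1) ≤ 0} (1 : (Fin d → ℝ) × ℝ → ℝ)) D :=
    (integrable_const (1 : ℝ)).indicator (measurableSet_nonpos v)
  unfold competitorLoss
  rw [integral_add (hi.const_mul _) (hj.const_mul _), integral_const_mul, integral_const_mul,
    integral_indicator_one (measurableSet_nonpos v)]
  gcongr
  exact integral_exp_neg_abs_dotProduct_le hA0 hv hε

/-- For a correctly classified point, `ℓ(z) ≤ exp (-z)` and the perturbation costs a factor of at
most `exp (B r / ε) ≤ exp κ`. For a misclassified point the perturbed margin is at least `-2 B / ε`,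
and the loss grows only linearly. -/
theorem crossEntropy_le_competitorLoss {v x δ : Fin d → ℝ} {y κ B r ε : ℝ} (hB : 0 ≤ B)
    (hr : 0 ≤ r) (hr1 : r ≤ 1) (hε : 0 < ε) (hκ : B * r / ε ≤ κ) (hv : v ⬝ᵥ v = 1)
    (hy : y = 1 ∨ y = -1) (hx : x ⬝ᵥ x ≤ B ^ 2) (hδ : δ ⬝ᵥ δ ≤ (B * r) ^ 2) :
    crossEntropy (y * ((ε⁻¹ • v) ⬝ᵥ (x + δ))) ≤ competitorLoss v κ B ε (x, y) := by
  have hx1 := abs_dotProduct_le (v := v) (a := 1) zero_le_one hB (by rw [hv]; norm_num) hx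
  have hd1 := abs_dotProduct_le (v := v) (a := 1) zero_le_one (by positivity)
    (by rw [hv]; norm_num) hδ
  rw [one_mul] at hx1 hd1
  have hyabs : |y| = 1 := by rcases hy with rfl | rfl <;> simp
  have e : y * ((ε⁻¹ • v) ⬝ᵥ (x + δ)) = (y * (v ⬝ᵥ x) + y * (v ⬝ᵥ δ)) / ε := by
    rw [smul_dotProduct, dotProduct_add, smul_eq_mul]
    field_simp
  have hyd : -(B * r) ≤ y * (v ⬝ᵥ δ) := by
    have : |y * (v ⬝ᵥ δ)| ≤ B * r := by rwa [abs_mul, hyabs, one_mul]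
    exact (abs_le.1 this).1
  have hyx : |y * (v ⬝ᵥ x)| = |v ⬝ᵥ x| := by rw [abs_mul, hyabs, one_mul]
  unfold competitorLoss
  by_cases h : y * (v ⬝ᵥ x) ≤ 0
  · rw [Set.indicator_of_mem (by exact h)]
    have h1 : -(2 * B / ε) ≤ y * ((ε⁻¹ • v) ⬝ᵥ (x + δ)) := by
      rw [e, ← neg_div]
      gcongr
      have := (abs_le.1 (hyx.le.trans hx1)).1
      nlinarith
    have h2 := crossEntropy_le_one_add _ (by positivity) h1
    have h3 := mul_pos (Real.exp_pos κ) (Real.exp_pos (-(|v ⬝ᵥ x| / ε)))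
    simp only [Pi.one_apply, mul_one]
    linarith
  · rw [Set.indicator_of_notMem (by exact h), mul_zero, add_zero]
    refine (crossEntropy_le_exp _).trans ?_
    rw [← Real.exp_add]
    refine Real.exp_le_exp.2 ?_
    push Not at h
    rw [abs_of_pos h] at hyx
    rw [e, hyx, add_div]
    have : -(B * r / ε) ≤ y * (v ⬝ᵥ δ) / ε := by
      rw [← neg_div]
      gcongr
    linarith

/-- Adversarial training finds an iterate whose empirical error is bounded in terms of the
empirical average of `competitorLoss`. -/
theorem IsAdversarialTraining.exists_empirical_le {p : ℝ≥0∞} (hp : 1 ≤ p)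
    {r η B κ ε b : ℝ} {S : Fin n → (Fin d → ℝ) × ℝ} {w : ℕ → Fin d → ℝ}
    (hw : IsAdversarialTraining p r η S w) (hw0 : w 0 = 0) (hB : 0 ≤ B) (hr : 0 ≤ r)
    (hr1 : r ≤ 1) (hη : 0 < η) (hηB : η * (4 * B ^ 2) ≤ 1) (hε : 0 < ε) (hκ : B * r / ε ≤ κ)
    (hn : 0 < n) (hpert : ∀ δ : Fin d → ℝ, vecNorm p δ ≤ r → δ ⬝ᵥ δ ≤ (B * r) ^ 2)
    (hyS : ∀ i, (S i).2 = 1 ∨ (S i).2 = -1) (hxS : ∀ i, (S i).1 ⬝ᵥ (S i).1 ≤ B ^ 2)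
    {v : Fin d → ℝ} (hv : v ⬝ᵥ v = 1) (hb : ∑ i, competitorLoss v κ B ε (S i) ≤ n * b) :
    ∃ k : ℕ, (k : ℝ) ≤ 1 / (η * ε ^ 3) ∧
      (∑ i, if (S i).2 * (w k ⬝ᵥ (S i).1) ≤ 0 then (1 : ℝ) else 0) ≤
        2 * (n * (2 * b + ε)) := by
  obtain ⟨δ, hδ, hstep⟩ := hw
  have hX : ∀ k i, ((S i).1 + δ k i) ⬝ᵥ ((S i).1 + δ k i) ≤ 4 * B ^ 2 := fun k i => by
    have h1 := hxS i
    have h2 := hpert _ (hδ k i).1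
    have h3 : (B * r) ^ 2 ≤ B ^ 2 := by
      rw [mul_pow]
      exact mul_le_of_le_one_right (sq_nonneg B) (pow_le_one₀ hr hr1)
    have h4 := abs_dotProduct_le hB hB h1 (h2.trans h3)
    rw [add_dotProduct, dotProduct_add, dotProduct_add, dotProduct_comm (δ k i) (S i).1]
    nlinarith [(abs_le.1 h4).2]
  obtain ⟨k, hk, hloss⟩ := exists_iterate_loss_le (fun k i => (S i).1 + δ k i)
    (fun i => (S i).2) (fun i => by rcases hyS i with h | h <;> rw [h] <;> norm_num) hX hη hηB
    hε hn w hw0 hstep (ε⁻¹ • v) (b := b) (fun k => le_trans (Finset.sum_le_sum fun i _ =>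
      crossEntropy_le_competitorLoss hB hr hr1 hε hκ hv (hyS i) (hxS i)
        (hpert _ (hδ k i).1)) hb)
  refine ⟨k, hk.trans (le_of_eq ?_), ?_⟩
  · rw [smul_dotProduct, dotProduct_smul, hv]
    simp only [smul_eq_mul]
    field_simp
  · refine le_trans ?_ (mul_le_mul_of_nonneg_left hloss zero_le_two)
    rw [Finset.mul_sum]
    refine Finset.sum_le_sum fun i _ => ?_
    split_ifs with h
    · have h1 := (hδ k i).2 0 (by rw [vecNorm_zero p hp]; exact hr)
      rw [add_zero] at h1
      linarith [half_le_crossEntropy h]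
    · exact mul_nonneg zero_le_two (crossEntropy_nonneg _)

end AdvHalfspace

/-! ### Success on the good event -/

namespace AdvHalfspace

variable {d : ℕ} {D : Measure ((Fin d → ℝ) × ℝ)}

/-- Adversarial training succeeds with high probability, when `B` bounds the Euclidean norm of the
data and some halfspace `v` has a robust error of at most `2 o`. -/
theorem measure_training_failure_le [IsProbabilityMeasure D] {p : ℝ≥0∞} (hp : 1 ≤ p)
    {r η B κ o A δ : ℝ} {n N : ℕ} (hB : 1 ≤ B) (ho : 0 < o) (hBo : B * o ≤ 1) (hr : 0 ≤ r)
    (hr1 : r ≤ 1) (hκ0 : 0 ≤ κ) (hrκ : r ≤ κ * o) (hη : 0 < η) (hηB : η * (4 * B ^ 2) ≤ 1)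
    (hA0 : 0 ≤ A) (hn : 0 < n) (hN : 0 < N) (hNo : d * (1 / N : ℝ) ≤ o) (hδ : 0 < δ)
    (hpert : ∀ δ : Fin d → ℝ, vecNorm p δ ≤ r → δ ⬝ᵥ δ ≤ (B * r) ^ 2)
    (hy : ∀ᵐ z ∂D, z.2 = 1 ∨ z.2 = -1) (hx : ∀ᵐ z ∂D, ∀ i, |z.1 i| ≤ 1)
    (hxB : ∀ᵐ z ∂D, z.1 ⬝ᵥ z.1 ≤ B ^ 2)
    (hA : ∀ v : Fin d → ℝ, v ⬝ᵥ v = 1 →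
      D.map (fun z => v ⬝ᵥ z.1) ≤ ENNReal.ofReal A • volume)
    {v : Fin d → ℝ} (hv : v ⬝ᵥ v = 1) (hvo : D.real {z | z.2 * (v ⬝ᵥ z.1) ≤ 0} ≤ 2 * o)
    (hgrid : (2 * N + 1) ^ d * Real.exp (-(2 * n * o ^ 2)) ≤ δ / 2)
    (hcomp : Real.exp (-(2 * n * √(B * o) ^ 2 /
      (Real.exp κ + (1 + 2 * B / √(B * o))) ^ 2)) ≤ δ / 2) :
    (Measure.pi fun _ : Fin n => D)
      {S | ¬ ∀ w : ℕ → Fin d → ℝ, IsAdversarialTraining p r η S w → w 0 = 0 →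
        ∃ k : ℕ, (k : ℝ) ≤ 1 / (η * √(B * o) ^ 3) ∧ robustError D p r (w k) ≤
          (2 * (2 * (2 * A * Real.exp κ + 7) + 1) + 1 + 2 * A * (2 + κ)) * √(B * o)} ≤
      ENNReal.ofReal δ := by
  set ε := √(B * o) with hεdef
  have hBo0 : 0 < B * o := by positivity
  have hε : 0 < ε := Real.sqrt_pos.2 hBo0
  have hε2 : ε * ε = B * o := Real.mul_self_sqrt hBo0.le
  have hε1 : ε ≤ 1 := Real.sqrt_le_one.2 hBo
  have hBoε : B * o ≤ ε := by rw [← hε2]; exact mul_le_of_le_one_left hε.le hε1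
  have hoε : o ≤ ε := le_trans (le_mul_of_one_le_left ho.le hB) hBoε
  set P := Measure.pi fun _ : Fin n => D with hP
  set bad₁ := {S : Fin n → (Fin d → ℝ) × ℝ | ¬ ∀ j : Fin d → Fin (2 * N + 1),
    ∑ i, slackIndicator (gridVector N j) (d * (1 / N)) (S i) <
      n * (∫ z, slackIndicator (gridVector N j) (d * (1 / N)) z ∂D + o)} with hbad₁
  set bad₂ := {S : Fin n → (Fin d → ℝ) × ℝ |
    n * (∫ z, competitorLoss v κ B ε z ∂D + ε) ≤ ∑ i, competitorLoss v κ B ε (S i)} with hbad₂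
  have h₁ : P bad₁ ≤ ENNReal.ofReal (δ / 2) :=
    (measure_pi_grid_le _ ho.le n).trans (ENNReal.ofReal_le_ofReal hgrid)
  have h₂ : P bad₂ ≤ ENNReal.ofReal (δ / 2) :=
    (measure_pi_sum_ge_le D (measurable_competitorLoss v κ B ε)
      (competitorLoss_mem_Icc v κ (by linarith) hε) hε.le n).trans (ENNReal.ofReal_le_ofReal hcomp)
  have hsum : P (bad₁ ∪ bad₂) ≤ ENNReal.ofReal δ := by
    refine (measure_union_le _ _).trans ((add_le_add h₁ h₂).trans (le_of_eq ?_))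
    rw [← ENNReal.ofReal_add (by positivity) (by positivity), add_halves]
  have hae : ∀ᵐ S ∂P, ∀ i, ((S i).2 = 1 ∨ (S i).2 = -1) ∧ (∀ l, |(S i).1 l| ≤ 1) ∧
      (S i).1 ⬝ᵥ (S i).1 ≤ B ^ 2 := by
    refine ae_all_iff.2 fun i => ?_
    exact (measurePreserving_eval (fun _ : Fin n => D) i).quasiMeasurePreserving.ae
      (hy.and (hx.and hxB))
  refine le_trans (measure_mono_ae ?_) hsum
  filter_upwards [hae] with S hS hfail
  by_contra hgood
  obtain ⟨hg₁, hg₂⟩ := not_or.1 (show ¬(S ∈ bad₁ ∨ S ∈ bad₂) from hgood)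
  refine hfail fun w hw hw0 => ?_
  have hg₁' : ∀ j : Fin d → Fin (2 * N + 1),
      ∑ i, slackIndicator (gridVector N j) (d * (1 / N)) (S i) <
      n * (∫ z, slackIndicator (gridVector N j) (d * (1 / N)) z ∂D + o) := not_not.1 hg₁
  have hg₂' : ∑ i, competitorLoss v κ B ε (S i) < n * (∫ z, competitorLoss v κ B ε z ∂D + ε) :=
    not_le.1 hg₂
  -- Misclassified points contribute `(1 + 2 B / ε) * 2 o = 2 o + 4 ε`, by `ε² = B o`; with `o ≤ ε`
  -- and the deviation `ε` this gives the `7`.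
  have hint : ∫ z, competitorLoss v κ B ε z ∂D + ε ≤ (2 * A * Real.exp κ + 7) * ε := by
    have h := integral_competitorLoss_le hA0 (hA v hv) κ B hε
    have h0 : 0 ≤ 1 + 2 * B / ε := by positivity
    have h3 := mul_le_mul_of_nonneg_left hvo h0
    have h4 : (1 + 2 * B / ε) * (2 * o) = 2 * o + 4 * ε := by
      field_simp
      linear_combination (-2 * 2 : ℝ) * hε2
    linarith
  have hn' : (0 : ℝ) < n := by exact_mod_cast hn
  have hBr : B * r ≤ κ * (B * o) := by
    calc B * r ≤ B * (κ * o) := by gcongr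
      _ = _ := by ring
  obtain ⟨k, hk, hemp⟩ := hw.exists_empirical_le hp hw0 (by linarith) hr hr1 hη hηB hε (κ := κ)
    (by
      rw [div_le_iff₀ hε]
      exact hBr.trans (mul_le_mul_of_nonneg_left hBoε hκ0)) hn hpert (fun i => (hS i).1)
    (fun i => (hS i).2.2) hv (hg₂'.le.trans (mul_le_mul_of_nonneg_left hint hn'.le))
  refine ⟨k, hk, ?_⟩
  have hgen := robustError_le_empirical hN (by positivity : 0 ≤ B * r) hA0 ho.le hpert hy hx hA
    (fun i => (hS i).1) (fun i => (hS i).2.1) hg₁' (w k)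
  have hκε : κ * (B * o) ≤ κ * ε := mul_le_mul_of_nonneg_left hBoε hκ0
  have hlast : A * (2 * (2 * (d * (1 / N : ℝ)) + B * r)) ≤ A * (2 * (2 * ε + κ * ε)) := by
    refine mul_le_mul_of_nonneg_left ?_ hA0
    linarith
  have h5 := hgen.trans (add_le_add_left hemp _)
  have h6 : robustError D p r (w k) ≤ 2 * (2 * ((2 * A * Real.exp κ + 7) * ε) + ε) +
      (o + A * (2 * (2 * (d * (1 / N : ℝ)) + B * r))) := by
    refine le_of_mul_le_mul_left ?_ hn'
    linarith
  linarith

end AdvHalfspace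

/-! ### Sample size, `OPT` and explicit constants -/

namespace AdvHalfspace

theorem exp_neg_log_le {d : ℕ} (hd : 2 ≤ d) {o δ : ℝ} (ho : 0 < o) (ho1 : o ≤ 1) (hδ : 0 < δ) :
    Real.exp (-Real.log (d / (o * δ))) ≤ δ / 2 := by
  have hd' : (2 : ℝ) ≤ d := by exact_mod_cast hd
  rw [Real.exp_neg, Real.exp_log (by positivity), inv_div, div_le_div_iff₀ (by positivity) two_pos]
  nlinarith [mul_pos ho hδ]

/-- The grid has at most `(d / o) ^ (4 d)` points, which adds `4 d log (d / o)` to the exponent.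
Since `d ≤ C₁ B²`, the term `2 n o²` outweighs it. -/
theorem grid_failure_le {d N n : ℕ} (hd : 2 ≤ d) {o δ B C C₁ : ℝ} (ho : 0 < o) (ho1 : o ≤ 1)
    (hδ : 0 < δ) (hδ1 : δ < 1) (hB : 1 ≤ B) (hdB : d ≤ C₁ * B ^ 2) (hC : 4 * C₁ + 1 ≤ 2 * C)
    (hN : (N : ℝ) ≤ d / o + 1) (hn : C * Real.log (d / (o * δ)) * (B ^ 2 / o ^ 2) ≤ n) :
    (2 * N + 1) ^ d * Real.exp (-(2 * n * o ^ 2)) ≤ δ / 2 := by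
  have hd' : (2 : ℝ) ≤ d := by exact_mod_cast hd
  set L := Real.log (d / (o * δ)) with hL
  set a : ℝ := d / o with ha
  have ha2 : 2 ≤ a := by
    rw [ha, le_div_iff₀ ho]
    nlinarith
  have haL : Real.log a ≤ L := by
    refine Real.log_le_log (by positivity) ?_
    rw [ha]
    gcongr
    exact mul_le_of_le_one_right ho.le hδ1.le
  have hL0 : 0 ≤ L := (Real.log_nonneg (by linarith)).trans haL
  have h1 : (2 * N + 1 : ℝ) ≤ Real.exp (4 * Real.log a) := by
    have e : Real.exp (4 * Real.log a) = a ^ 4 := by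
      rw [mul_comm, Real.exp_mul, Real.exp_log (by positivity)]
      norm_cast
    rw [e]
    have h2 : 8 * a ≤ a ^ 4 := by
      have : (2 : ℝ) ^ 3 ≤ a ^ 3 := by gcongr
      calc 8 * a = 2 ^ 3 * a := by norm_num
        _ ≤ a ^ 3 * a := by gcongr
        _ = a ^ 4 := by ring
    linarith
  have h3 : C * L * B ^ 2 ≤ n * o ^ 2 := by
    have := mul_le_mul_of_nonneg_right hn (sq_nonneg o)
    calc C * L * B ^ 2 = C * L * (B ^ 2 / o ^ 2) * o ^ 2 := by field_simp
      _ ≤ _ := this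
  have h4 : d * (4 * Real.log a) + L ≤ 2 * n * o ^ 2 := by
    have hLB : 0 ≤ L * B ^ 2 := by positivity
    have h5 : d * (4 * Real.log a) ≤ C₁ * B ^ 2 * (4 * L) := by
      have : 0 ≤ Real.log a := Real.log_nonneg (by linarith)
      exact mul_le_mul hdB (by linarith) (by positivity) ((Nat.cast_nonneg d).trans hdB)
    have h6 : L ≤ L * B ^ 2 := le_mul_of_one_le_right hL0 (one_le_pow₀ hB)
    have h7 := mul_le_mul_of_nonneg_right hC hLB
    linarith
  calc (2 * N + 1 : ℝ) ^ d * Real.exp (-(2 * n * o ^ 2))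
      ≤ Real.exp (4 * Real.log a) ^ d * Real.exp (-(2 * n * o ^ 2)) := by gcongr
    _ = Real.exp (d * (4 * Real.log a) - 2 * n * o ^ 2) := by
        rw [← Real.exp_nat_mul, ← Real.exp_add, sub_eq_add_neg]
    _ ≤ Real.exp (-L) := Real.exp_le_exp.2 (by linarith)
    _ ≤ δ / 2 := exp_neg_log_le hd ho ho1 hδ

/-- The range of the loss is at most `(exp κ + 3) B / ε`, and `ε⁴ / B² = o²`. Hence `n` of order
`log (d / (o δ)) / o²` suffices, and the factor `B²` in the sample size is to spare. -/
theorem competitor_failure_le {d n : ℕ} (hd : 2 ≤ d) {o δ B C κ : ℝ} (ho : 0 < o) (ho1 : o ≤ 1)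
    (hδ : 0 < δ) (hδ1 : δ < 1) (hB : 1 ≤ B) (hBo : B * o ≤ 1)
    (hC : (Real.exp κ + 3) ^ 2 ≤ 2 * C)
    (hn : C * Real.log (d / (o * δ)) * (B ^ 2 / o ^ 2) ≤ n) :
    Real.exp (-(2 * n * √(B * o) ^ 2 / (Real.exp κ + (1 + 2 * B / √(B * o))) ^ 2)) ≤ δ / 2 := by
  have hd' : (2 : ℝ) ≤ d := by exact_mod_cast hd
  set L := Real.log (d / (o * δ)) with hL
  have hL0 : 0 ≤ L := by
    refine Real.log_nonneg ?_
    rw [le_div_iff₀ (by positivity), one_mul]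
    have : o * δ ≤ 1 := mul_le_one₀ ho1 hδ.le hδ1.le
    linarith
  refine le_trans (Real.exp_le_exp.2 (neg_le_neg ?_)) (exp_neg_log_le hd ho ho1 hδ)
  rw [← hL]
  set ε := √(B * o) with hε
  have hε0 : 0 < ε := Real.sqrt_pos.2 (by positivity)
  have hε1 : ε ≤ 1 := Real.sqrt_le_one.2 hBo
  have hε2 : ε ^ 2 = B * o := Real.sq_sqrt (by positivity)
  have hek := Real.exp_pos κ
  have hG : Real.exp κ + (1 + 2 * B / ε) ≤ (Real.exp κ + 3) * (B / ε) := by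
    have : 1 ≤ B / ε := by
      rw [le_div_iff₀ hε0]
      linarith
    have e : 2 * B / ε = 2 * (B / ε) := by ring
    rw [e]
    nlinarith
  have hG0 : 0 < Real.exp κ + (1 + 2 * B / ε) := by positivity
  rw [le_div_iff₀ (by positivity)]
  calc L * (Real.exp κ + (1 + 2 * B / ε)) ^ 2 ≤ L * ((Real.exp κ + 3) * (B / ε)) ^ 2 := by gcongr
    _ = (Real.exp κ + 3) ^ 2 * (L * (B / ε) ^ 2) := by ring
    _ ≤ 2 * C * (L * (B / ε) ^ 2) := by gcongr
    _ = 2 * C * L * (B / o) := by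
        rw [div_pow, hε2]
        field_simp
    _ ≤ 2 * C * L * (B / o) * B ^ 2 := by
        have hC0 : 0 ≤ 2 * C := (sq_nonneg _).trans hC
        exact le_mul_of_one_le_right (by positivity) (one_le_pow₀ hB)
    _ = 2 * (C * L * (B ^ 2 / o ^ 2)) * ε ^ 2 := by
        rw [hε2]
        field_simp
    _ ≤ 2 * n * ε ^ 2 := by gcongr

/-- The factor `2` avoids showing that the infimum is attained. Scale invariance replaces the `ℓ_q`
normalization by the Euclidean one. Positivity of `OPT` rules out an empty sphere, whose real
infimum is `0` by convention. -/
theorem exists_robustError_le_two_mul_robustOpt {d : ℕ} {D : Measure ((Fin d → ℝ) × ℝ)}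
    {p q : ℝ≥0∞} (hq : 1 ≤ q) {r : ℝ} (ho : 0 < robustOpt D p q r) :
    ∃ v : Fin d → ℝ, v ⬝ᵥ v = 1 ∧ robustError D p r v ≤ 2 * robustOpt D p q r := by
  have hne : Nonempty {w : Fin d → ℝ // vecNorm q w = 1} := by
    by_contra h
    rw [not_nonempty_iff] at h
    simp [robustOpt, Real.iInf_of_isEmpty] at ho
  obtain ⟨⟨w, hw⟩, hlt⟩ := exists_lt_of_ciInf_lt
    (show robustOpt D p q r < 2 * robustOpt D p q r by linarith)
  have hw0 : w ≠ 0 := by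
    rintro rfl
    rw [vecNorm_zero q hq] at hw
    exact zero_ne_one hw
  obtain ⟨c, v, hc, rfl, hv⟩ := exists_unit_smul hw0
  refine ⟨v, hv, ?_⟩
  rw [robustError_smul p r hc] at hlt
  exact hlt.le

theorem robustOpt_le_one {d : ℕ} {D : Measure ((Fin d → ℝ) × ℝ)} [IsProbabilityMeasure D]
    (p q : ℝ≥0∞) (r : ℝ) : robustOpt D p q r ≤ 1 := by
  rcases isEmpty_or_nonempty {w : Fin d → ℝ // vecNorm q w = 1} with h | ⟨⟨w⟩⟩
  · simp [robustOpt, Real.iInf_of_isEmpty]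
  · exact (ciInf_le ⟨0, by rintro _ ⟨w, rfl⟩; exact measureReal_nonneg⟩ w).trans measureReal_le_one

theorem le_robustOpt {d : ℕ} {D : Measure ((Fin d → ℝ) × ℝ)} {p q : ℝ≥0∞} (hq : 1 ≤ q)
    {r a : ℝ} (ho : 0 < robustOpt D p q r)
    (h : ∀ w : Fin d → ℝ, w ≠ 0 → a ≤ robustError D p r w) : a ≤ robustOpt D p q r := by
  have hne : Nonempty {w : Fin d → ℝ // vecNorm q w = 1} := by
    by_contra h
    rw [not_nonempty_iff] at h
    simp [robustOpt, Real.iInf_of_isEmpty] at ho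
  refine le_ciInf fun w => h _ ?_
  intro h0
  have := w.2
  rw [h0, vecNorm_zero q hq] at this
  exact zero_ne_one this

/-- Adversarial training with the constants made explicit, for `B = d ^ (1/2 - 1/p)`: a robust error
of order `√(B OPT)` is reached within `1 / (η √(B OPT) ^ 3)` steps. -/
theorem adversarialTraining_robustError_le {U U' R : ℝ} (hU : 0 < U) (hU' : 0 < U') (hR : 0 < R)
    {d : ℕ} (hd : 2 ≤ d) {p q : ℝ≥0∞} (hp : 2 ≤ p) (hq : 1 ≤ q) {r : ℝ} (hr : 0 ≤ r)
    (hrR : r ≤ R) {D : Measure ((Fin d → ℝ) × ℝ)} [IsProbabilityMeasure D]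
    (hy : ∀ᵐ z ∂D, z.2 = 1 ∨ z.2 = -1) (hx : ∀ᵐ z ∂D, vecNorm p z.1 ≤ 1)
    (hA : AntiConcentrated D.fst U) (hAA : AntiAntiConcentrated D.fst U' R)
    {η : ℝ} (hη : 0 < η) {B o : ℝ} (hB : 1 ≤ B) (hBd : B ^ 2 = (d : ℝ) ^ (1 - 2 * p⁻¹.toReal))
    (ho : o = robustOpt D p q r) (ho0 : 0 < o) (hηB : η * (4 * B ^ 2) ≤ 1)
    {δ : ℝ} (hδ : 0 < δ) (hδ1 : δ < 1) {n : ℕ} {C : ℝ}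
    (hC₁ : 4 * (128 * U' / R ^ 4) + 1 ≤ 2 * C) (hC₂ : (Real.exp (2 * U' / R) + 3) ^ 2 ≤ 2 * C)
    (hn : C * Real.log (d / (o * δ)) * (B ^ 2 / o ^ 2) ≤ n) :
    (Measure.pi fun _ : Fin n => D)
      {S | ¬ ∀ w : ℕ → Fin d → ℝ, IsAdversarialTraining p r η S w → w 0 = 0 →
        ∃ k : ℕ, (k : ℝ) ≤ 1 / (η * √(B * o) ^ 3) ∧ robustError D p r (w k) ≤
          max (1 + 2 * U' / R) (2 * (2 * (2 * (3 * U) * Real.exp (2 * U' / R) + 7) + 1) + 1 +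
            2 * (3 * U) * (2 + 2 * U' / R)) * √(B * o)} ≤
      ENNReal.ofReal δ := by
  have hd' : (2 : ℝ) ≤ d := by exact_mod_cast hd
  have ho1 : o ≤ 1 := ho ▸ robustOpt_le_one p q r
  set κ := 2 * U' / R with hκ
  have hκ0 : 0 < κ := by positivity
  have hBo0 : 0 < B * o := by positivity
  -- In this case the error bound is at least `1` and `w 0` satisfies it. Otherwise `B o ≤ 1` and `r
  -- ≤ κ o ≤ 1`, as the main argument requires.
  by_cases htriv : 1 ≤ (1 + κ) * (B * o)
  · refine le_trans (le_of_eq ?_) zero_le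
    convert measure_empty (μ := Measure.pi fun _ : Fin n => D)
    refine Set.eq_empty_of_forall_notMem fun S hS => hS fun w _ _ => ⟨0, by rw [Nat.cast_zero]; positivity, ?_⟩
    refine le_trans measureReal_le_one (le_trans ?_
      (mul_le_mul_of_nonneg_right (le_max_left _ _) (Real.sqrt_nonneg _)))
    rcases le_total (B * o) 1 with h | h
    · refine htriv.trans (mul_le_mul_of_nonneg_left ?_ (by positivity))
      exact Real.le_sqrt_of_sq_le (by nlinarith)
    · have : 1 ≤ √(B * o) := Real.one_le_sqrt.2 h
      nlinarith
  push Not at htriv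
  have hBo : B * o ≤ 1 := by nlinarith
  have hrκ : r ≤ κ * o := by
    have h : r * R / (2 * U') ≤ o := by
      rw [ho]
      exact le_robustOpt hq (ho ▸ ho0) fun w hw => le_robustError hp hr hrR hR hU' hd hy hAA hw
    rw [div_le_iff₀ (by positivity)] at h
    rw [hκ, div_mul_eq_mul_div, le_div_iff₀ hR]
    linarith
  have hr1 : r ≤ 1 := by
    have : o ≤ B * o := le_mul_of_one_le_left ho0.le hB
    nlinarith
  have hxi : ∀ᵐ z ∂D, ∀ i, |z.1 i| ≤ 1 := by
    filter_upwards [hx] with z hz i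
    exact (abs_apply_le_vecNorm hp z.1 i).trans hz
  have hvec0 : ∀ x : Fin d → ℝ, 0 ≤ vecNorm p x := fun x =>
    (abs_nonneg _).trans (abs_apply_le_vecNorm hp x ⟨0, by omega⟩)
  have hball : ∀ (x : Fin d → ℝ) (s : ℝ), vecNorm p x ≤ s → x ⬝ᵥ x ≤ (B * s) ^ 2 := by
    intro x s hxs
    refine (dotProduct_self_le_vecNorm hp (by omega) x).trans ?_
    rw [← hBd, mul_pow]
    have := hvec0 x
    gcongr
  have hxB : ∀ᵐ z ∂D, z.1 ⬝ᵥ z.1 ≤ B ^ 2 := by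
    filter_upwards [hx] with z hz
    simpa using hball z.1 1 hz
  have hfst : ∀ {P : (Fin d → ℝ) → Prop}, MeasurableSet {x | P x} →
      (∀ᵐ z ∂D, P z.1) → ∀ᵐ x ∂D.fst, P x := fun hP h =>
    (ae_map_iff measurable_fst.aemeasurable hP).2 h
  have hdB : (d : ℝ) ≤ 128 * U' / R ^ 4 * B ^ 2 := by
    refine hAA.dim_le hU' hd hR (hfst ?_ hxB)
    refine measurableSet_le ?_ measurable_const
    unfold dotProduct
    fun_prop
  have hA1 : ∀ v : Fin d → ℝ, v ⬝ᵥ v = 1 →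
      D.map (fun z => v ⬝ᵥ z.1) ≤ ENNReal.ofReal (3 * U) • volume := fun v hv => by
    rw [map_fst_dotProduct]
    refine hA.map_dotProduct_le hd (hfst ?_ hxi) hv
    have : {x : Fin d → ℝ | ∀ i, |x i| ≤ 1} = ⋂ i, {x | |x i| ≤ 1} := by ext; simp
    rw [this]
    exact MeasurableSet.iInter fun i => measurableSet_le (by fun_prop) measurable_const
  obtain ⟨v, hv, hvo⟩ := exists_robustError_le_two_mul_robustOpt hq (ho ▸ ho0)
  rw [← ho] at hvo
  have hvo' := (measureReal_nonpos_le_robustError hp hr hy v).trans hvo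
  have hn0 : 0 < n := by
    have hL : 0 < Real.log (d / (o * δ)) := by
      refine Real.log_pos ?_
      rw [lt_div_iff₀ (by positivity), one_mul]
      have : o * δ ≤ 1 := mul_le_one₀ ho1 hδ.le hδ1.le
      linarith
    have hC : 0 < C := by
      have : 0 < (Real.exp κ + 3) ^ 2 := by positivity
      linarith
    have : (0 : ℝ) < n := lt_of_lt_of_le (by positivity) hn
    exact_mod_cast this
  have hdo : 0 < d / o := by positivity
  -- With `N = ⌈d / o⌉` the grid error `d / N` of the margins is at most `o`.
  refine (measure_mono ?_).trans (measure_training_failure_le (p := p) (r := r) (η := η) (B := B)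
    (κ := κ) (o := o) (A := 3 * U) (N := ⌈d / o⌉₊) (le_trans (by norm_num) hp) hB ho0 hBo hr hr1
    hκ0.le hrκ hη hηB (by positivity) hn0 (Nat.ceil_pos.2 hdo) ?_ hδ (fun δ' => hball δ' r) hy hxi
    hxB hA1 hv hvo'
    (grid_failure_le hd ho0 ho1 hδ hδ1 hB hdB hC₁ (Nat.ceil_lt_add_one hdo.le).le hn)
    (competitor_failure_le hd ho0 ho1 hδ hδ1 hB hBo hC₂ hn))
  · intro S hS hgood
    refine hS fun w hw hw0 => ?_
    obtain ⟨k, hk, hk'⟩ := hgood w hw hw0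
    exact ⟨k, hk, hk'.trans
      (mul_le_mul_of_nonneg_right (le_max_right _ _) (Real.sqrt_nonneg _))⟩
  · have h := Nat.le_ceil ((d : ℝ) / o)
    have hN : (0 : ℝ) < (⌈(d : ℝ) / o⌉₊ : ℝ) := lt_of_lt_of_le hdo h
    rw [mul_one_div, div_le_iff₀ hN]
    rw [div_le_iff₀ ho0] at h
    linarith

/-- The argument yields `o ^ (-3/2)` steps; as `o ≤ 1`, the stated `o ^ (-3)` is weaker. -/
theorem one_div_mul_sqrt_pow_le {η B o : ℝ} (hη : 0 < η) (hB : 1 ≤ B) (ho0 : 0 < o) (ho1 : o ≤ 1) :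
    1 / (η * √(B * o) ^ 3) ≤ η⁻¹ * (1 / √B ^ 3) / o ^ 3 := by
  have hso : √o ^ 3 * √o ^ 3 = o ^ 3 := by
    rw [← mul_pow, Real.mul_self_sqrt ho0.le]
  have hso1 : √o ^ 3 ≤ 1 := pow_le_one₀ (Real.sqrt_nonneg o) (Real.sqrt_le_one.2 ho1)
  have hso0 : 0 < √o ^ 3 := pow_pos (Real.sqrt_pos.2 ho0) 3
  have hsB : 0 < √B ^ 3 := pow_pos (Real.sqrt_pos.2 (by linarith)) 3
  have h3 : o ^ 3 ≤ √o ^ 3 := by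
    rw [← hso]
    exact mul_le_of_le_one_left hso0.le hso1
  rw [Real.sqrt_mul (by linarith), mul_pow]
  have e : η⁻¹ * (1 / √B ^ 3) / o ^ 3 = 1 / (η * (√B ^ 3 * o ^ 3)) := by
    field_simp
  rw [e]
  exact one_div_le_one_div_of_le (by positivity)
    (mul_le_mul_of_nonneg_left (mul_le_mul_of_nonneg_left h3 hsB.le) hη.le)

theorem four_mul_rpow_le {p : ℝ≥0∞} (hp : 2 ≤ p) {d : ℕ} (hd : 1 ≤ d) :
    4 * (d : ℝ) ^ (1 - 2 * p⁻¹.toReal) ≤ if p ≤ 2 then 4 else 4 * (d : ℝ) := by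
  have hd1 : (1 : ℝ) ≤ d := by exact_mod_cast hd
  split_ifs with h
  · rw [le_antisymm h hp]
    norm_num
  · have h0 : 0 ≤ p⁻¹.toReal := ENNReal.toReal_nonneg
    have := Real.rpow_le_rpow_of_exponent_le hd1 (by linarith : 1 - 2 * p⁻¹.toReal ≤ 1)
    rw [Real.rpow_one] at this
    linarith

end AdvHalfspace

/-! ### The bounds in terms of `d`, `p` and `OPT` -/

theorem corollary2 (U U' R : ℝ) (hU : 0 < U) (hU' : 0 < U') (hR : 0 < R) :
    -- the constants depend on `U`, `U'`, `R` only
    ∃ (C : ℝ) (m : ℕ), 0 < C ∧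
      ∀ (d : ℕ) (_ : 2 ≤ d) (p q : ℝ≥0∞) (_ : 2 ≤ p) (_ : p.HolderConjugate q)
        (r : ℝ) (_ : 0 ≤ r) (_ : r ≤ R)
        (D : Measure ((Fin d → ℝ) × ℝ)) (_ : IsProbabilityMeasure D)
        (_ : ∀ᵐ z ∂D, z.2 = 1 ∨ z.2 = -1)
        (_ : ∀ᵐ z ∂D, vecNorm p z.1 ≤ 1)
        (_ : AntiConcentrated D.fst U) (_ : AntiAntiConcentrated D.fst U' R)
        (η : ℝ) (_ : 0 < η)
        (_ : η ≤ robustOpt D p q r / (4 * (if p ≤ 2 then 4 else 4 * (d : ℝ))))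
        (δ : ℝ) (_ : 0 < δ) (_ : δ < 1)
        (n : ℕ)
        (_ : C * Real.log (d / (robustOpt D p q r * δ)) ^ m *
          ((d : ℝ) ^ (1 - 2 * p⁻¹.toReal) / robustOpt D p q r ^ 2) ≤ n),
        -- with probability at least `1 - δ` over the i.i.d. sample `S` of size `n`,
        -- every run from `w 0 = 0` finds such a classifier
        Measure.pi (fun _ : Fin n => D)
          {S | ¬ ∀ w : ℕ → Fin d → ℝ, IsAdversarialTraining p r η S w → w 0 = 0 →
            ∃ k : ℕ,
              (k : ℝ) ≤ C * Real.log (d / robustOpt D p q r) ^ m *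
                (η⁻¹ * (d : ℝ) ^ (3 / 2 * p⁻¹.toReal - 3 / 4) / robustOpt D p q r ^ 3) ∧
              robustError D p r (w k) ≤ C * Real.log (d / robustOpt D p q r) ^ m *
                ((d : ℝ) ^ (1 / 4 - 1 / 2 * p⁻¹.toReal) * √(robustOpt D p q r) +
                  (d : ℝ) ^ (1 / 2 - p⁻¹.toReal) * robustOpt D p q r) ∧
              (p = 2 → robustError D p r (w k) ≤
                C * Real.log (d / robustOpt D p q r) ^ m * √(robustOpt D p q r)) ∧
              (p = ∞ → robustError D p r (w k) ≤
                C * Real.log (d / robustOpt D p q r) ^ m *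
                  ((d : ℝ) ^ (1 / 4 : ℝ) * √(robustOpt D p q r) +
                    (d : ℝ) ^ (1 / 2 : ℝ) * robustOpt D p q r))} ≤
          ENNReal.ofReal δ := by
  set κ := 2 * U' / R with hκ
  set K := max (1 + κ) (2 * (2 * (2 * (3 * U) * Real.exp κ + 7) + 1) + 1 + 2 * (3 * U) * (2 + κ))
    with hK
  have hκ0 : 0 < κ := by positivity
  have hK0 : 0 < K := lt_of_lt_of_le (by positivity) (le_max_left _ _)
  -- As `log (d / o) ≥ 1 / 2`, the summands `2` and `2 * K` give `C log (d / o) ≥ 1` and `≥ K`; the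
  -- other two serve the two sample size conditions. One power of the logarithm suffices.
  set C := 2 + 2 * K + (4 * (128 * U' / R ^ 4) + 1) + (Real.exp κ + 3) ^ 2 with hC
  have hU'R : 0 < 128 * U' / R ^ 4 := by positivity
  have hexp : 0 < (Real.exp κ + 3) ^ 2 := by positivity
  have hC0 : 0 < C := by positivity
  refine ⟨C, 1, hC0, ?_⟩
  intro d hd p q hp hpq r hr hrR D hD hy hx hA hAA η hη hηo δ hδ hδ1 n hn
  set o := robustOpt D p q r with ho
  have hd' : (2 : ℝ) ≤ d := by exact_mod_cast hd
  have hd0 : (0 : ℝ) < d := by linarith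
  have hH : 0 < 4 * (if p ≤ 2 then 4 else 4 * (d : ℝ)) := by split_ifs <;> positivity
  -- A positive step size below a multiple of `OPT` forces `OPT > 0`.
  have ho0 : 0 < o := by
    by_contra h
    have := div_nonpos_of_nonpos_of_nonneg (not_lt.1 h) hH.le
    linarith
  have ho1 : o ≤ 1 := robustOpt_le_one p q r
  have hq : 1 ≤ q := ENNReal.HolderConjugate.one_le q p
  set s := p⁻¹.toReal with hs
  have hs0 : 0 ≤ s := ENNReal.toReal_nonneg
  have hs2 : s ≤ 1 / 2 := by
    have := ENNReal.toReal_mono (by simp) (ENNReal.inv_le_inv.2 hp)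
    simpa [hs] using this
  set B : ℝ := (d : ℝ) ^ (1 / 2 - s) with hB
  have hB1 : 1 ≤ B := Real.one_le_rpow (by linarith) (by linarith)
  have hBd : B ^ 2 = (d : ℝ) ^ (1 - 2 * s) := by
    rw [hB, ← Real.rpow_natCast, ← Real.rpow_mul hd0.le]
    congr 1; push_cast; ring
  have hsqrt : √(B * o) = (d : ℝ) ^ (1 / 4 - 1 / 2 * s) * √o := by
    rw [Real.sqrt_mul (by positivity), hB, Real.sqrt_eq_rpow, ← Real.rpow_mul hd0.le]
    congr 2; ring
  have hB3 : (d : ℝ) ^ (3 / 2 * s - 3 / 4) = 1 / √B ^ 3 := by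
    rw [hB, Real.sqrt_eq_rpow, ← Real.rpow_mul hd0.le, ← Real.rpow_natCast, ← Real.rpow_mul hd0.le,
      one_div, ← Real.rpow_neg hd0.le]
    congr 1; push_cast; ring
  have hηB : η * (4 * B ^ 2) ≤ 1 := by
    have hBH := four_mul_rpow_le hp (by omega : 1 ≤ d)
    rw [← hs, ← hBd] at hBH
    rw [le_div_iff₀ hH] at hηo
    have := mul_le_mul_of_nonneg_left hBH hη.le
    have : 0 < η * (4 * B ^ 2) := by positivity
    linarith
  have hΛ : 1 / 2 ≤ Real.log (d / o) := by
    have h1 : (2 : ℝ) ≤ d / o := by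
      rw [le_div_iff₀ ho0]
      nlinarith
    have := Real.log_le_log two_pos h1
    linarith [Real.log_two_gt_d9]
  have hCK : K ≤ C * Real.log (d / o) ^ 1 := by
    rw [pow_one]
    nlinarith
  have hC1 : 1 ≤ C * Real.log (d / o) ^ 1 := by
    rw [pow_one]
    nlinarith
  rw [pow_one, ← hBd] at hn
  refine (measure_mono ?_).trans (adversarialTraining_robustError_le hU hU' hR hd hp hq hr hrR hy hx
    hA hAA hη hB1 hBd ho ho0 hηB hδ hδ1 (C := C) (by linarith) (by linarith) hn)
  intro S hS hgood
  refine hS fun w hw hw0 => ?_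
  obtain ⟨k, hk, herr⟩ := hgood w hw hw0
  have herr' : robustError D p r (w k) ≤ C * Real.log (d / o) ^ 1 *
      ((d : ℝ) ^ (1 / 4 - 1 / 2 * s) * √o) := by
    rw [← hsqrt]
    exact herr.trans (mul_le_mul_of_nonneg_right hCK (Real.sqrt_nonneg _))
  have hΛ0 : 0 ≤ C * Real.log (d / o) ^ 1 := by linarith
  refine ⟨k, hk.trans ?_, herr'.trans ?_, fun hp2 => herr'.trans ?_, fun hpt => herr'.trans ?_⟩
  · refine le_trans ?_ (mul_le_mul_of_nonneg_right hC1 (by positivity))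
    rw [hB3, one_mul]
    exact one_div_mul_sqrt_pow_le hη hB1 ho0 ho1
  · exact mul_le_mul_of_nonneg_left (le_add_of_nonneg_right (by positivity)) hΛ0
  · have : s = 1 / 2 := by rw [hs, hp2]; simp
    rw [this]
    norm_num
  · have : s = 0 := by rw [hs, hpt]; simp
    rw [this]
    refine mul_le_mul_of_nonneg_left ?_ hΛ0
    norm_num
    positivity
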